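/- Let $n,k$ be integers with $1<k\le n$. A tuple $(a_1,\dots,a_n)$ of positive integers is a \emph{parking function} if some rearrangement of it is weakly increasing with $i$-th entry at most $i$ for every $i$. Let $\mathrm{PF}_{n,k}$ be the set of parking functions $a$ of length $n$ in which $k$ does not occur but each of $k+1,\dots,n$ occurs. Let $\mathrm{NC}_{n+1}$ be the set of noncrossing partitions of $\{1,\dots,n+1\}$, ordered by refinement (finer partitions are smaller). A covering relation $\sigma\lessdot\tau$ in $\mathrm{NC}_{n+1}$ joins two blocks $B_1,B_2$ of $\sigma$ to one block $B=B_1\cup B_2$ of $\tau$; choosing the names so that $\min B\in B_1$, we label it by the largest element of $B_1$ that is smaller than all elements of $B_2$. Reading the labels from bottom to top, each maximal chain of $\mathrm{NC}_{n+1}$ gives a parking function of length $n$. Let $\mathrm{Poset}(\mathrm{PF}_{n,k})$ be the poset whose Hasse diagram is the union of the maximal chains of $\mathrm{NC}_{n+1}$ whose label sequence lies in $\mathrm{PF}_{n,k}$: its elements are the noncrossing partitions on these chains, and its order is the reflexive transitive closure of the covering relations occurring in these chains. \textbf{Theorem.} $\mathrm{Poset}(\mathrm{PF}_{n,k})$ admits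 a symmetric chain decomposition: it is graded, and its elements can be partitioned into saturated chains such that, for each chain, the ranks of its minimum and its maximum sum to the height of the poset (the length of its longest chains). -/

import Mathlib

namespace ParkingPoset

/-- A tuple `(a₁, …, aₙ)` of positive integers is a parking function if some rearrangement of it
is weakly increasing with `i`-th entry at most `i`. The index set `Fin n` stands for `{1, …, n}`,
so the position `i : Fin n` is the `(i + 1)`-st one. -/
def IsParkingFunction {n : ℕ} (a : Fin n → ℕ) : Prop :=
  (∀ i, 1 ≤ a i) ∧
    ∃ s : Equiv.Perm (Fin n), Monotone (a ∘ s) ∧ ∀ i : Fin n, a (s i) ≤ (i : ℕ) + 1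

/-- `PF_{n,k}`: the parking functions of length `n` whose largest missing number is `k`. -/
def PF (n k : ℕ) : Set (Fin n → ℕ) :=
  {a | IsParkingFunction a ∧ k ∉ Set.range a ∧ ∀ j, k + 1 ≤ j → j ≤ n → j ∈ Set.range a}

/-- A partition of `Fin m`, given as an equivalence relation, is noncrossing if there are no
`a < b < c < d` with `a, c` in one block and `b, d` in a different block. -/
def IsNoncrossing {m : ℕ} (r : Setoid (Fin m)) : Prop :=
  ∀ a b c d : Fin m, a < b → b < c → c < d → r a c → r b d → r a b

/-- The noncrossing partitions of an `m`-element set, ordered by refinement (`π ≤ ρ` when every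
block of `π` is contained in a block of `ρ`). The point `i : Fin m` stands for the number
`i + 1` of `{1, …, m}`. -/
abbrev NC (m : ℕ) : Type := {r : Setoid (Fin m) // IsNoncrossing r}

/-- `c` is a maximal chain of `NC_{n+1}`, that is, a path from bottom to top in its Hasse diagram.
Each such path has exactly `n` steps, since each covering relation merges two blocks. -/
def IsMaximalChain {n : ℕ} (c : Fin (n + 1) → NC (n + 1)) : Prop :=
  IsBot (c 0) ∧ IsTop (c (Fin.last n)) ∧ ∀ i : Fin n, c i.castSucc ⋖ c i.succ

/-- `ℓ` is the label of the covering relation from `p` to `q`: if `q` arises from `p` by joining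
the blocks `B₁` and `B₂` to a block `B`, where `B₁` contains the minimum of `B`, then `ℓ` is the
largest number in `B₁` that is less than all elements of `B₂`. -/
def IsEdgeLabel {m : ℕ} (p q : NC m) (ℓ : ℕ) : Prop :=
  ∃ B₁ ∈ p.1.classes, ∃ B₂ ∈ p.1.classes, B₁ ≠ B₂ ∧ B₁ ∪ B₂ ∈ q.1.classes ∧
    (∃ x ∈ B₁, IsLeast (B₁ ∪ B₂) x) ∧
    ∃ b : Fin m, IsGreatest {y | y ∈ B₁ ∧ ∀ z ∈ B₂, y < z} b ∧ ℓ = (b : ℕ) + 1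

/-- `c` is a maximal chain of `NC_{n+1}` whose sequence of labels, read from bottom to top, is a
parking function in `PF_{n,k}`. -/
def IsPFChain (n k : ℕ) (c : Fin (n + 1) → NC (n + 1)) : Prop :=
  IsMaximalChain c ∧
    ∃ a ∈ PF n k, ∀ i : Fin n, IsEdgeLabel (c i.castSucc) (c i.succ) (a i)

/-- The edges of the union of the chains that correspond to `PF_{n,k}`. -/
def IsPFEdge (n k : ℕ) (p q : NC (n + 1)) : Prop :=
  ∃ c, IsPFChain n k c ∧ ∃ i : Fin n, c i.castSucc = p ∧ c i.succ = q

/-- The underlying set of `Poset(PF_{n,k})`: the noncrossing partitions that lie on a maximal chain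
corresponding to an element of `PF_{n,k}`. -/
def PosetPF (n k : ℕ) : Type :=
  {p : NC (n + 1) // ∃ c, IsPFChain n k c ∧ p ∈ Set.range c}

theorem IsPFEdge.covBy {n k : ℕ} {p q : NC (n + 1)} (h : IsPFEdge n k p q) : p ⋖ q := by
  obtain ⟨c, hc, i, rfl, rfl⟩ := h
  exact hc.1.2.2 i

theorem le_of_reflTransGen {n k : ℕ} {p q : NC (n + 1)}
    (h : Relation.ReflTransGen (IsPFEdge n k) p q) : p ≤ q := by
  induction h with
  | refl => exact le_rfl
  | tail _ h ih => exact ih.trans h.covBy.le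

/-- `Poset(PF_{n,k})` is ordered by the reflexive transitive closure of the union of the chains
that correspond to `PF_{n,k}`; this is in general not the order induced from `NC_{n+1}`. -/
instance instPartialOrderPosetPF (n k : ℕ) : PartialOrder (PosetPF n k) where
  le p q := Relation.ReflTransGen (IsPFEdge n k) p.1 q.1
  le_refl _ := Relation.ReflTransGen.refl
  le_trans _ _ _ := Relation.ReflTransGen.trans
  le_antisymm _ _ h h' := Subtype.ext (le_antisymm (le_of_reflTransGen h) (le_of_reflTransGen h'))

/-- The Hasse diagram of `Poset(PF_{n,k})` is the union of the chains corresponding to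
`PF_{n,k}`. -/
theorem PosetPF.covBy_iff {n k : ℕ} (p q : PosetPF n k) : p ⋖ q ↔ IsPFEdge n k p.1 q.1 := by
  constructor
  · intro h
    have hle : Relation.ReflTransGen (IsPFEdge n k) p.1 q.1 := h.le
    rcases Relation.ReflTransGen.cases_head hle with h0 | ⟨r, hpr, hrq⟩
    · exact absurd (Subtype.ext h0) h.ne
    · obtain ⟨c, hc, i, hi, hr⟩ := id hpr
      let s : PosetPF n k := ⟨r, c, hc, _, hr⟩
      have hpr' : p ≤ s := Relation.ReflTransGen.single hpr
      have hrq' : s ≤ q := hrq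
      rcases h.eq_or_eq hpr' hrq' with h1 | h1
      · exact absurd (congrArg Subtype.val h1).symm hpr.covBy.ne
      · have h2 : r = q.1 := congrArg Subtype.val h1
        exact h2 ▸ hpr
  · intro h
    have hne : p ≠ q := fun h0 => h.covBy.ne (congrArg Subtype.val h0)
    have hpq : p ≤ q := Relation.ReflTransGen.single h
    refine ⟨lt_of_le_of_ne hpq hne, fun r h1 h2 => ?_⟩
    have h1' : p.1 < r.1 := lt_of_le_of_ne (le_of_reflTransGen h1.le)
      fun h0 => h1.ne (Subtype.ext h0)
    have h2' : r.1 < q.1 := lt_of_le_of_ne (le_of_reflTransGen h2.le)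
      fun h0 => h2.ne (Subtype.ext h0)
    exact h.covBy.2 h1' h2'

/-- A poset is graded by `Order.height` (the length of a longest chain ending at an element) if
this goes up by one along every covering relation; it is then the rank function. -/
def IsGradedByHeight (P : Type*) [PartialOrder P] : Prop :=
  ∀ x y : P, x ⋖ y → Order.height y = Order.height x + 1

/-- A chain is saturated if its consecutive elements are related by a covering relation of the
whole poset. -/
def IsSaturatedChain {P : Type*} [PartialOrder P] (C : Set P) : Prop :=
  IsChain (· ≤ ·) C ∧ ∀ x y : C, x ⋖ y → (x : P) ⋖ (y : P)

/-- A symmetric chain decomposition: the poset is graded, and its elements can be partitioned into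
saturated chains such that the ranks of the minimum and of the maximum of each chain sum to the
height of the poset. -/
def HasSymmetricChainDecomposition (P : Type*) [PartialOrder P] : Prop :=
  IsGradedByHeight P ∧
    ∃ D : Set (Set P), Setoid.IsPartition D ∧
      ∀ C ∈ D, IsSaturatedChain C ∧
        ∃ x y : P, IsLeast C x ∧ IsGreatest C y ∧
          ((Order.height x + Order.height y : ℕ∞) : WithBot ℕ∞) = Order.krullDim P

end ParkingPoset

/-!
The elements of `Poset(PF_{n,k})` can be described explicitly (`Admissible`). Count the points from
`0`, and let `v` stand for the number `k + 1` and `u` for `k`. Since each label beyond `k` occurs,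
a point `x` beyond `v` is joined to a smaller point with the label that belongs to its
predecessor; so in each partition on the chains such an `x` is a block minimum or lies in the block
of `x - 1`.
Since `k` is no label, `v` is never joined to a block containing `u` while it is the minimum of its
own block; this excludes the partitions in which `u, v` is the part up to `v` of a block, and those
in which `0` is in the block of `u` but not of `v`. Conversely, from a partition with these
properties one can go down to the bottom and up to the top without leaving them and without the
label `k`, and the labels along such a path automatically form a member of `PF_{n,k}`
(`admissible_of_isPFChain`, `isPFChain_of_isAdmissibleMerge`, `mem_range_isPFChain_iff`).

To decompose the admissible partitions, draw for each block that does not contain `0` an arc from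
its minimum to its largest element that is at most `v`, if these differ. The remaining nonzero
points are free. A free point either is the minimum of its block or has been absorbed: by the block
of `x - 1` if it lies beyond `v`, and otherwise by the block of the innermost arc around it, or by
the block of `0` if there is none. A partition is determined by its arcs and its absorbed points
(`eq_of_isArc_eq`), and, as long as only noncrossing partitions and the condition beyond `v` are
concerned, the set of absorbed points can be chosen freely (`exists_absorbed_eq`). The excluded
partitions are those with the arc `(u, v)` and those in which `u` and `v` are free and `u` but not
`v` is absorbed. Hence for given arcs the admissible partitions form a product of two-element
chains, one for each free point, except that the factors of `u` and `v`, if both are free, are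
replaced by one three-element chain. With `m` arcs there are `n - 2 m` free points, and the ranks go
from `m` to `n - m`. So all these products are centred at `n / 2`, and each of them decomposes into
symmetric chains (`hasSymmetricPaths_subsets`).
-/

namespace ParkingPoset

/-! ### Symmetric paths in products of chains -/

/-- The set `F`, ranked by `ρ`, is a disjoint union of `E`-paths that are symmetric about `N / 2`:
the path through `x` is the fibre of `c` over `c x`, it meets every rank from `lo (c x)` to
`N - lo (c x)` exactly once, and no other rank. -/
def HasSymmetricPaths {α : Type} (F : Set α) (E : α → α → Prop) (ρ : α → ℕ) (N : ℕ) : Prop :=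
  ∃ (ι : Type) (c : α → ι) (lo : ι → ℕ),
    (∀ x ∈ F, ∀ y ∈ F, c x = c y → ρ x = ρ y → x = y) ∧
    (∀ x ∈ F, lo (c x) ≤ ρ x ∧ ρ x + lo (c x) ≤ N) ∧
    (∀ x ∈ F, ∀ t, lo (c x) ≤ t → t + lo (c x) ≤ N → ∃ y ∈ F, c y = c x ∧ ρ y = t) ∧
    ∀ x ∈ F, ∀ y ∈ F, c x = c y → ρ y = ρ x + 1 → E x y

/-- `S'` arises from `S` by adding one element. -/
def AddsOne {V : Type} [DecidableEq V] (S S' : Finset V) : Prop :=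
  ∃ y, y ∉ S ∧ S' = insert y S

section
variable {V : Type} [DecidableEq V]

/-- The product with a two-element chain: from a path `x₀, …, x_ℓ` of the first factor one gets the
path `(x₀, 0), …, (x_ℓ, 0), (x_ℓ, 1)` and, unless it is empty, the path
`(x₀, 1), …, (x_{ℓ - 1}, 1)`. -/
theorem HasSymmetricPaths.of_erase_mem {F F' : Set (Finset V)} {N : ℕ} {x : V}
    (h : HasSymmetricPaths F AddsOne Finset.card N) (hx : ∀ S ∈ F, x ∉ S)
    (hF : ∀ S, S ∈ F' ↔ S.erase x ∈ F) :
    HasSymmetricPaths F' AddsOne Finset.card (N + 1) := by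
  classical
  obtain ⟨ι, c, lo, inj, rng, full, edge⟩ := h
  -- `up S` says that `S` is in the second copy and its projection is not the end of its path
  let up : Finset V → Prop := fun S =>
    x ∈ S ∧ (S.erase x).card + lo (c (S.erase x)) ≠ N
  have card1 : ∀ S : Finset V, x ∈ S → S.card = (S.erase x).card + 1 := fun S hS =>
    (Finset.card_erase_add_one hS).symm
  have card0 : ∀ S : Finset V, x ∉ S → S.erase x = S := fun S hS => Finset.erase_eq_of_notMem hS
  have ext1 : ∀ S S' : Finset V, (x ∈ S ↔ x ∈ S') → S.erase x = S'.erase x → S = S' := by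
    intro S S' h1 h2
    by_cases hS : x ∈ S
    · rw [← Finset.insert_erase hS, h2, Finset.insert_erase (h1.1 hS)]
    · rw [← card0 S hS, h2, card0 S' (fun h => hS (h1.2 h))]
  refine ⟨ι × Bool, fun S => (c (S.erase x), decide (up S)),
    fun i => lo i.1 + (if i.2 then 1 else 0), ?_, ?_, ?_, ?_⟩
  · intro S hS S' hS' hc hρ
    simp only [Prod.mk.injEq, decide_eq_decide] at hc
    obtain ⟨hc, hup⟩ := hc
    have hF1 := (hF S).1 hS
    have hF2 := (hF S').1 hS'
    have r1 := rng _ hF1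
    have r2 := rng _ hF2
    rw [hc] at r1
    by_cases h1 : x ∈ S <;> by_cases h2 : x ∈ S'
    · have := card1 S h1
      have := card1 S' h2
      exact ext1 _ _ (by simp [h1, h2]) (inj _ hF1 _ hF2 hc (by omega))
    · exfalso
      have := card1 S h1
      have e2 := card0 S' h2
      rw [e2] at r2 hc
      have hn : ¬ up S := fun h => h2 (hup.1 h).1
      simp only [up, h1, true_and, not_not] at hn
      rw [hc] at hn
      rw [e2] at r1
      omega
    · exfalso
      have := card1 S' h2
      have e2 := card0 S h1
      have hn : ¬ up S' := fun h => h1 (hup.2 h).1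
      simp only [up, h2, true_and, not_not] at hn
      rw [e2] at r1
      omega
    · rw [card0 S h1] at hF1 hc
      rw [card0 S' h2] at hF2 hc
      exact inj _ hF1 _ hF2 hc hρ
  · intro S hS
    have r1 := rng _ ((hF S).1 hS)
    by_cases h1 : x ∈ S
    · have := card1 S h1
      by_cases hu : up S
      · have := hu.2
        simp only [hu, decide_true, if_true]
        omega
      · simp only [hu, decide_false]
        simp
        omega
    · have hu : ¬ up S := fun h => h1 h.1
      simp only [hu, decide_false]
      rw [card0 S h1] at r1 ⊢
      simp
      omega
  · intro S hS t ht1 ht2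
    have hF1 := (hF S).1 hS
    have hxe : x ∉ S.erase x := Finset.notMem_erase x S
    by_cases hu : up S
    · simp only [hu, decide_true, if_true] at ht1 ht2 ⊢
      obtain ⟨U, hU, hcU, hρU⟩ := full _ hF1 (t - 1) (by omega) (by omega)
      have hxU := hx U hU
      have e1 : (insert x U).erase x = U := Finset.erase_insert hxU
      refine ⟨insert x U, (hF _).2 (by rwa [e1]), ?_, ?_⟩
      · have : up (insert x U) := by
          refine ⟨Finset.mem_insert_self _ _, ?_⟩
          rw [e1, hcU]; omega
        simp only [e1, this, hcU, decide_true]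
      · rw [Finset.card_insert_of_notMem hxU]; omega
    · simp only [hu, decide_false] at ht1 ht2 ⊢
      simp only [Bool.false_eq_true, if_false, add_zero] at ht1 ht2
      have r1 := rng _ hF1
      by_cases htN : t + lo (c (S.erase x)) ≤ N
      · obtain ⟨U, hU, hcU, hρU⟩ := full _ hF1 t (by omega) htN
        have hxU := hx U hU
        refine ⟨U, (hF _).2 (by rwa [card0 U hxU]), ?_, hρU⟩
        have : ¬ up U := fun h => hxU h.1
        simp only [card0 U hxU, this, hcU, decide_false]
      · obtain ⟨U, hU, hcU, hρU⟩ := full _ hF1 (t - 1) (by omega) (by omega)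
        have hxU := hx U hU
        have e1 : (insert x U).erase x = U := Finset.erase_insert hxU
        refine ⟨insert x U, (hF _).2 (by rwa [e1]), ?_, ?_⟩
        · have : ¬ up (insert x U) := by
            rintro ⟨-, h⟩
            rw [e1, hcU] at h; omega
          simp only [e1, this, hcU, decide_false]
        · rw [Finset.card_insert_of_notMem hxU]; omega
  · intro S hS S' hS' hc hρ
    simp only [Prod.mk.injEq, decide_eq_decide] at hc
    obtain ⟨hc, hup⟩ := hc
    have hF1 := (hF S).1 hS
    have hF2 := (hF S').1 hS'
    have r1 := rng _ hF1
    have r2 := rng _ hF2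
    by_cases h1 : x ∈ S <;> by_cases h2 : x ∈ S'
    · have := card1 S h1
      have := card1 S' h2
      obtain ⟨y, hy, hy'⟩ := edge _ hF1 _ hF2 hc (by omega)
      have hyx : y ≠ x := by
        rintro rfl
        exact Finset.notMem_erase y S' (hy' ▸ Finset.mem_insert_self _ _)
      refine ⟨y, fun h => hy (Finset.mem_erase.2 ⟨hyx, h⟩), ?_⟩
      rw [← Finset.insert_erase h2, hy', Finset.insert_comm, Finset.insert_erase h1]
    · exfalso
      have := card1 S h1
      have hn : ¬ up S := fun h => h2 (hup.1 h).1
      simp only [up, h1, true_and, not_not] at hn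
      rw [hc] at hn
      rw [card0 S' h2] at hn r2
      omega
    · have := card1 S' h2
      have e2 := card0 S h1
      have : S = S'.erase x := by
        rw [e2] at hF1 hc
        exact inj _ hF1 _ hF2 hc (by omega)
      exact ⟨x, h1, by rw [this, Finset.insert_erase h2]⟩
    · rw [card0 S h1] at hF1 hc
      rw [card0 S' h2] at hF2 hc
      exact edge _ hF1 _ hF2 hc hρ

/-- The subsets of `T` that contain `v` if they contain `u` (a condition imposed only if both
belong to `T`) form a Boolean lattice or the product of a Boolean lattice and the three-element
chain `∅, {v}, {u, v}`. -/
theorem hasSymmetricPaths_subsets (T : Finset V) {u v : V} (huv : u ≠ v) :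
    HasSymmetricPaths {S | S ⊆ T ∧ (u ∈ T → v ∈ T → u ∈ S → v ∈ S)} AddsOne Finset.card
      T.card := by
  classical
  -- a family of subsets of `T₀` may be multiplied by the two-element chains of the points of `T₁`
  have key : ∀ (F₀ : Finset V → Prop) (T₀ : Finset V),
      (∀ S, F₀ S → S ⊆ T₀) →
      HasSymmetricPaths {S | F₀ S} AddsOne Finset.card T₀.card →
      ∀ T₁ : Finset V, Disjoint T₀ T₁ →
      HasSymmetricPaths {S | S ⊆ T₀ ∪ T₁ ∧ F₀ (S ∩ T₀)} AddsOne Finset.card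
        (T₀ ∪ T₁).card := by
    intro F₀ T₀ hF₀ h0 T₁
    induction T₁ using Finset.induction_on with
    | empty =>
      intro _
      have : {S | S ⊆ T₀ ∪ ∅ ∧ F₀ (S ∩ T₀)} = {S | F₀ S} := by
        ext S
        simp only [Finset.union_empty, Set.mem_ofPred_eq]
        constructor
        · rintro ⟨h1, h2⟩
          rwa [Finset.inter_eq_left.2 h1] at h2
        · intro h
          refine ⟨hF₀ S h, ?_⟩
          rwa [Finset.inter_eq_left.2 (hF₀ S h)]
      rw [this, Finset.union_empty]
      exact h0
    | insert x T₁ hx ih =>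
      intro hd
      rw [Finset.disjoint_insert_right] at hd
      have hxu : x ∉ T₀ ∪ T₁ := by simp [hd.1, hx]
      rw [Finset.union_insert, Finset.card_insert_of_notMem hxu]
      refine (ih hd.2).of_erase_mem (x := x) (fun S hS h => hxu (hS.1 h)) fun S => ?_
      have : S.erase x ∩ T₀ = S ∩ T₀ := by
        ext z
        simp only [Finset.mem_inter, Finset.mem_erase]
        constructor
        · rintro ⟨⟨-, h1⟩, h2⟩; exact ⟨h1, h2⟩
        · rintro ⟨h1, h2⟩
          exact ⟨⟨fun h => hd.1 (h ▸ h2), h1⟩, h2⟩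
      simp only [Set.mem_ofPred_eq, this, Finset.subset_insert_iff]
  by_cases hT : u ∈ T ∧ v ∈ T
  · obtain ⟨hu, hv⟩ := hT
    have hsub : ({u, v} : Finset V) ⊆ T := by
      intro z hz; simp only [Finset.mem_insert, Finset.mem_singleton] at hz
      rcases hz with rfl | rfl <;> assumption
    have h := key (fun S => S ⊆ {u, v} ∧ (u ∈ S → v ∈ S)) {u, v} (fun S h => h.1) ?_
      (T \ {u, v}) Finset.disjoint_sdiff
    · rw [Finset.union_sdiff_of_subset hsub] at h
      convert h using 1
      ext S
      simp [hu, hv]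
    · have hc : ({u, v} : Finset V).card = 2 := Finset.card_pair huv
      have cases3 : ∀ S : Finset V, S ⊆ {u, v} → (u ∈ S → v ∈ S) →
          S = ∅ ∨ S = {v} ∨ S = {u, v} := by
        intro S h1 h2
        by_cases hu : u ∈ S
        · right; right
          apply Finset.Subset.antisymm h1
          intro z hz; simp only [Finset.mem_insert, Finset.mem_singleton] at hz
          rcases hz with rfl | rfl
          · exact hu
          · exact h2 hu
        · by_cases hv : v ∈ S
          · right; left
            ext z
            simp only [Finset.mem_singleton]
            refine ⟨fun hz => ?_, fun h => h ▸ hv⟩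
            have := h1 hz
            simp only [Finset.mem_insert, Finset.mem_singleton] at this
            rcases this with rfl | rfl
            · exact absurd hz hu
            · rfl
          · left
            ext z
            simp only [Finset.notMem_empty, iff_false]
            intro hz
            have := h1 hz
            simp only [Finset.mem_insert, Finset.mem_singleton] at this
            rcases this with rfl | rfl
            · exact hu hz
            · exact hv hz
      refine ⟨Unit, fun _ => (), fun _ => 0, ?_, ?_, ?_, ?_⟩
      · rintro S ⟨h1, h2⟩ S' ⟨h1', h2'⟩ - hρ
        rcases cases3 S h1 h2 with rfl | rfl | rfl <;>
        rcases cases3 S' h1' h2' with rfl | rfl | rfl <;> simp [hc] at hρ ⊢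
      · rintro S ⟨h1, h2⟩
        exact ⟨Nat.zero_le _, Finset.card_le_card h1⟩
      · rintro S - t - ht
        rw [hc] at ht
        obtain rfl | rfl | rfl : t = 0 ∨ t = 1 ∨ t = 2 := by omega
        · exact ⟨∅, by simp, rfl, rfl⟩
        · exact ⟨{v}, by simp, rfl, by simp⟩
        · exact ⟨{u, v}, by simp, rfl, hc⟩
      · rintro S ⟨h1, h2⟩ S' ⟨h1', h2'⟩ - hρ
        rcases cases3 S h1 h2 with rfl | rfl | rfl <;>
        rcases cases3 S' h1' h2' with rfl | rfl | rfl <;> simp [hc] at hρ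
        · exact ⟨v, by simp, by simp⟩
        · exact ⟨u, by simpa using huv, rfl⟩
  · have h := key (fun S => S ⊆ ∅) ∅ (fun S h => h) ?_ T (Finset.disjoint_empty_left _)
    · rw [Finset.empty_union] at h
      convert h using 1
      ext S
      simp only [Set.mem_ofPred_eq, Finset.inter_empty, Finset.subset_empty, and_true,
        and_iff_left_iff_imp]
      exact fun _ hu hv => absurd ⟨hu, hv⟩ hT
    · refine ⟨Unit, fun _ => (), fun _ => 0, ?_, ?_, ?_, ?_⟩
      · rintro S h1 S' h2 - -
        rw [Finset.subset_empty.1 h1, Finset.subset_empty.1 h2]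
      · rintro S h1
        exact ⟨Nat.zero_le _, Finset.card_le_card h1⟩
      · rintro S h1 t - ht
        refine ⟨S, h1, rfl, ?_⟩
        rw [Finset.subset_empty.1 h1]
        simp only [Finset.card_empty, add_zero, nonpos_iff_eq_zero] at ht ⊢
        exact ht.symm
      · rintro S h1 S' h2 - hρ
        rw [Finset.subset_empty.1 h1, Finset.subset_empty.1 h2] at hρ
        simp at hρ

end

/-! ### Joining two blocks of a noncrossing partition -/

section
variable {m : ℕ}

/-- `x` is the least element of its block. -/
def IsBlockMin (r : Setoid (Fin m)) (x : Fin m) : Prop := ∀ y, r x y → x ≤ y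

theorem exists_blockMin (r : Setoid (Fin m)) (x : Fin m) :
    ∃ y, r y x ∧ IsBlockMin r y ∧ y ≤ x := by
  obtain ⟨y, hy, h⟩ := wellFounded_lt.has_min {y | r y x} ⟨x, r.refl x⟩
  exact ⟨y, hy, fun z hz => not_lt.1 (h z (r.trans (r.symm hz) hy)), not_lt.1 (h x (r.refl x))⟩

theorem IsBlockMin.eq {r : Setoid (Fin m)} {x y : Fin m} (hx : IsBlockMin r x)
    (hy : IsBlockMin r y) (h : r x y) : x = y :=
  le_antisymm (hx y h) (hy x (r.symm h))

theorem IsBlockMin.anti {r s : Setoid (Fin m)} (h : r ≤ s) {x : Fin m} (hx : IsBlockMin s x) :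
    IsBlockMin r x := fun y hy => hx y (h hy)

open Classical in
/-- The rank of a partition: the number of elements minus the number of blocks. -/
noncomputable def rank (r : Setoid (Fin m)) : ℕ :=
  (Finset.univ.filter fun x => ¬ IsBlockMin r x).card

/-- `q` arises from `p` by joining the block with minimum `x` to a block with a smaller minimum.
This is expressed by saying that `q` is coarser, and `x` is the only element that ceases to be the
minimum of its block. -/
structure IsMerge (p q : Setoid (Fin m)) (x : Fin m) : Prop where
  le : p ≤ q
  min : IsBlockMin p x
  not_min : ¬ IsBlockMin q x
  min_of_ne : ∀ y, y ≠ x → IsBlockMin p y → IsBlockMin q y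

theorem IsMerge.rank_eq {p q : Setoid (Fin m)} {x : Fin m} (h : IsMerge p q x) :
    rank q = rank p + 1 := by
  classical
  have : (Finset.univ.filter fun x => ¬ IsBlockMin q x) =
      insert x (Finset.univ.filter fun x => ¬ IsBlockMin p x) := by
    ext y
    simp only [Finset.mem_filter, Finset.mem_univ, true_and, Finset.mem_insert]
    by_cases hy : y = x
    · subst hy; simp [h.not_min]
    · simp only [hy, false_or]
      exact ⟨fun h1 h2 => h1 (h.min_of_ne y hy h2), fun h1 h2 => h1 (h2.anti h.le)⟩
  unfold rank
  rw [this, Finset.card_insert_of_notMem]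
  simp [h.min]

/-- A partition is determined by its block minima among the partitions finer than a given one. -/
theorem eq_of_le_of_blockMin {p q : Setoid (Fin m)} (h : p ≤ q)
    (hm : ∀ x, IsBlockMin p x → IsBlockMin q x) : p = q := by
  refine le_antisymm h fun a b hab => ?_
  obtain ⟨a', ha, hma, -⟩ := exists_blockMin p a
  obtain ⟨b', hb, hmb, -⟩ := exists_blockMin p b
  have : a' = b' := (hm _ hma).eq (hm _ hmb)
    (q.trans (h ha) (q.trans hab (q.symm (h hb))))
  exact p.trans (p.symm ha) (this ▸ hb)

theorem rank_lt_rank {p q : Setoid (Fin m)} (h : p < q) : rank p < rank q := by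
  classical
  refine Finset.card_lt_card ?_
  rw [Finset.ssubset_iff_subset_ne]
  refine ⟨fun x hx => ?_, fun he => h.ne (eq_of_le_of_blockMin h.le fun x hx => ?_)⟩
  · simp only [Finset.mem_filter, Finset.mem_univ, true_and] at hx ⊢
    exact fun h' => hx (h'.anti h.le)
  · by_contra hq
    have : x ∈ Finset.univ.filter fun x => ¬ IsBlockMin p x := by
      rw [he]; simp [hq]
    simp [hx] at this

theorem IsMerge.lt {p q : Setoid (Fin m)} {x : Fin m} (h : IsMerge p q x) : p < q :=
  lt_of_le_of_ne h.le fun he => h.not_min (he ▸ h.min)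

theorem IsMerge.covBy {p q : NC m} {x : Fin m} (h : IsMerge p.1 q.1 x) : p ⋖ q := by
  refine ⟨h.lt, fun r h1 h2 => ?_⟩
  have := rank_lt_rank (p := p.1) (q := r.1) h1
  have := rank_lt_rank (p := r.1) (q := q.1) h2
  have := h.rank_eq
  omega

/-- The block that is joined to a block with a smaller minimum is the block of `x`. -/
theorem IsMerge.rel {p q : Setoid (Fin m)} {x : Fin m} (h : IsMerge p q x) {a b : Fin m}
    (hab : q a b) : p a b ∨ p a x ∨ p b x := by
  obtain ⟨a', ha, hma, -⟩ := exists_blockMin p a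
  obtain ⟨b', hb, hmb, -⟩ := exists_blockMin p b
  by_cases h1 : a' = x
  · exact .inr (.inl (p.symm (h1 ▸ ha)))
  by_cases h2 : b' = x
  · exact .inr (.inr (p.symm (h2 ▸ hb)))
  have : a' = b' := (h.min_of_ne _ h1 hma).eq (h.min_of_ne _ h2 hmb)
    (q.trans (h.le ha) (q.trans hab (q.symm (h.le hb))))
  exact .inl (p.trans (p.symm ha) (this ▸ hb))

theorem IsMerge.rel_of_not {p q : Setoid (Fin m)} {x : Fin m} (h : IsMerge p q x) {a b : Fin m}
    (hab : q a b) (ha : ¬ p a x) (hb : ¬ p b x) : p a b := by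
  rcases h.rel hab with h | h | h
  · exact h
  · exact absurd h ha
  · exact absurd h hb

/-- `y` is the predecessor of `x` in its block of `q`. -/
def IsPred (q : Setoid (Fin m)) (y x : Fin m) : Prop :=
  y < x ∧ q y x ∧ ∀ z, q z x → z < x → z ≤ y

theorem exists_isPred {q : Setoid (Fin m)} {x : Fin m} (h : ¬ IsBlockMin q x) :
    ∃ y, IsPred q y x := by
  unfold IsBlockMin at h
  push Not at h
  obtain ⟨z, hz, hzx⟩ := h
  obtain ⟨y, hy, hm⟩ := wellFounded_gt.has_min {y | q y x ∧ y < x} ⟨z, q.symm hz, hzx⟩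
  exact ⟨y, hy.2, hy.1, fun w h1 h2 => not_lt.1 (hm w ⟨h1, h2⟩)⟩

/-- The label of a covering relation is the predecessor, in the joined block, of the minimum of the
second block. -/
theorem IsMerge.isEdgeLabel {p q : NC m} {x y : Fin m} (h : IsMerge p.1 q.1 x)
    (hy : IsPred q.1 y x) : IsEdgeLabel p q (y + 1) := by
  have hyx : ¬ p.1 y x := fun h1 => absurd (h.min y (p.1.symm h1)) (not_le.2 hy.1)
  have hB : ∀ z, q.1 z x → ¬ p.1 z x → p.1 z y := fun z h1 h2 =>
    h.rel_of_not (q.1.trans h1 (q.1.symm hy.2.1)) h2 hyx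
  have hun : {z | p.1 z y} ∪ {z | p.1 z x} = {z | q.1 z x} := by
    ext z
    simp only [Set.mem_union, Set.mem_ofPred_eq]
    constructor
    · rintro (h1 | h1)
      · exact q.1.trans (h.le h1) hy.2.1
      · exact h.le h1
    · intro h1
      by_cases h2 : p.1 z x
      · exact .inr h2
      · exact .inl (hB z h1 h2)
  refine ⟨{z | p.1 z y}, ⟨y, rfl⟩, {z | p.1 z x}, ⟨x, rfl⟩, ?_, ?_, ?_, y, ⟨⟨?_, ?_⟩, ?_⟩, rfl⟩
  · intro he
    have : y ∈ {z | p.1 z x} := he ▸ p.1.refl y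
    exact hyx this
  · rw [hun]; exact ⟨x, rfl⟩
  · obtain ⟨w, hw, hmw, hwx⟩ := exists_blockMin q.1 x
    refine ⟨w, hB w hw fun h1 => h.not_min ?_, hun ▸ hw, ?_⟩
    · have : x = w := le_antisymm (h.min w (p.1.symm h1)) hwx
      exact this ▸ hmw
    · rw [hun]
      exact fun z hz => hmw z (q.1.trans hw (q.1.symm hz))
  · exact p.1.refl y
  · exact fun z hz => hy.1.trans_le (h.min z (p.1.symm hz))
  · rintro z ⟨h1, h2⟩
    exact hy.2.2 z (q.1.trans (h.le h1) hy.2.1) (h2 x (p.1.refl x))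

/-- The partition obtained by joining the blocks of `a` and `b`. -/
def join (r : Setoid (Fin m)) (a b : Fin m) : Setoid (Fin m) where
  r x y := r x y ∨ ((r x a ∨ r x b) ∧ (r y a ∨ r y b))
  iseqv := by
    refine ⟨fun x => .inl (r.refl x), ?_, ?_⟩
    · rintro x y (h | h)
      · exact .inl (r.symm h)
      · exact .inr ⟨h.2, h.1⟩
    · rintro x y z (h | h) (h' | h')
      · exact .inl (r.trans h h')
      · exact .inr ⟨h'.1.imp (r.trans h) (r.trans h), h'.2⟩
      · exact .inr ⟨h.1, h.2.imp (r.trans (r.symm h')) (r.trans (r.symm h'))⟩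
      · exact .inr ⟨h.1, h'.2⟩

theorem join_rel {r : Setoid (Fin m)} {a b x y : Fin m} :
    join r a b x y ↔ r x y ∨ ((r x a ∨ r x b) ∧ (r y a ∨ r y b)) := Iff.rfl

theorem join_rel_self (r : Setoid (Fin m)) (a b : Fin m) : join r a b a b :=
  .inr ⟨.inl (r.refl a), .inr (r.refl b)⟩

theorem isMerge_join {r : Setoid (Fin m)} {a x : Fin m} (hx : IsBlockMin r x) (hax : a < x) :
    IsMerge r (join r a x) x := by
  refine ⟨fun _ _ h => .inl h, hx, fun h => ?_, fun y hy hm z hz => ?_⟩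
  · exact absurd (h a ((join r a x).symm (join_rel_self r a x))) (not_le.2 hax)
  · rcases hz with hz | ⟨h1 | h1, h2 | h2⟩
    · exact hm z hz
    · exact hm z (r.trans h1 (r.symm h2))
    · exact (hm a h1).trans (hax.le.trans (hx z (r.symm h2)))
    · exact absurd (hm.eq hx h1) hy
    · exact absurd (hm.eq hx h1) hy

/-- Joining the blocks of `a` and `b` keeps a partition noncrossing if no two points of a third
block separate `a` from `b`. -/
theorem IsNoncrossing.join {r : Setoid (Fin m)} (hr : IsNoncrossing r) {a b : Fin m}
    (h : ∀ c d, r c d → ¬ r c a → ¬ r c b → c < d → ((c < a ∧ a < d) ↔ (c < b ∧ b < d))) :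
    IsNoncrossing (join r a b) := by
  -- a third block has all points of a given block on the same side
  have side : ∀ c d s t, r c d → r s t → ¬ r c s → c < s → s < d → c < t ∧ t < d := by
    intro c d s t hcd hst hcs h1 h2
    have ht : ¬ r c t := fun h' => hcs (r.trans h' (r.symm hst))
    refine ⟨lt_of_not_ge fun hle => ?_, lt_of_not_ge fun hle => ?_⟩
    · rcases hle.lt_or_eq with h3 | h3
      · exact ht (r.symm (hr t c s d h3 h1 h2 (r.symm hst) hcd))
      · exact ht (h3 ▸ r.refl t)
    · rcases hle.lt_or_eq with h3 | h3
      · exact hcs (hr c s d t h1 h2 h3 hcd hst)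
      · exact ht (h3 ▸ hcd)
  intro w x y z h1 h2 h3 hwy hxz
  by_cases hxin : r x a ∨ r x b
  · rcases hwy with hwy | hwy
    · rcases hxz with hxz | hxz
      · exact .inl (hr w x y z h1 h2 h3 hwy hxz)
      · by_cases hwin : r w a ∨ r w b
        · exact .inr ⟨hwin, hxin⟩
        · exfalso
          push Not at hwin
          have hb := h w y hwy hwin.1 hwin.2 (h1.trans h2)
          -- the pair `w, y` has `x` inside and `z` outside
          have aux : ∀ s, r x s → w < s ∧ s < y := fun s hs =>
            side w y x s hwy hs (fun h' => by
              rcases hxin with h4 | h4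
              · exact hwin.1 (r.trans h' h4)
              · exact hwin.2 (r.trans h' h4)) h1 h2
          have aux2 : ∀ s, r s z → ¬ (w < s ∧ s < y) := fun s hs h4 => by
            have hws : ¬ r w s := fun h' => by
              have h5 := r.trans h' hs
              rcases hxz.2 with h6 | h6
              · exact hwin.1 (r.trans h5 h6)
              · exact hwin.2 (r.trans h5 h6)
            exact absurd (side w y s z hwy hs hws h4.1 h4.2).2 (not_lt.2 h3.le)
          rcases hxz.1 with h4 | h4 <;> rcases hxz.2 with h5 | h5
          · exact aux2 x (r.trans h4 (r.symm h5)) ⟨h1, h2⟩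
          · exact aux2 b (r.symm h5) (hb.1 (aux a h4))
          · exact aux2 a (r.symm h5) (hb.2 (aux b h4))
          · exact aux2 x (r.trans h4 (r.symm h5)) ⟨h1, h2⟩
    · exact .inr ⟨hwy.1, hxin⟩
  · rcases hxz with hxz | hxz
    · rcases hwy with hwy | hwy
      · exact .inl (hr w x y z h1 h2 h3 hwy hxz)
      · exfalso
        push Not at hxin
        have hb := h x z hxz hxin.1 hxin.2 (h2.trans h3)
        have aux : ∀ s, r y s → x < s ∧ s < z := fun s hs =>
          side x z y s hxz hs (fun h' => by
            rcases hwy.2 with h4 | h4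
            · exact hxin.1 (r.trans h' h4)
            · exact hxin.2 (r.trans h' h4)) h2 h3
        have aux2 : ∀ s, r s w → ¬ (x < s ∧ s < z) := fun s hs h4 => by
          have hws : ¬ r x s := fun h' => by
            have h5 := r.trans h' hs
            rcases hwy.1 with h6 | h6
            · exact hxin.1 (r.trans h5 h6)
            · exact hxin.2 (r.trans h5 h6)
          exact absurd (side x z s w hxz hs hws h4.1 h4.2).1 (not_lt.2 h1.le)
        rcases hwy.1 with h4 | h4 <;> rcases hwy.2 with h5 | h5
        · exact aux2 y (r.trans h5 (r.symm h4)) ⟨h2, h3⟩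
        · exact aux2 a (r.symm h4) (hb.2 (aux b h5))
        · exact aux2 b (r.symm h4) (hb.1 (aux a h5))
        · exact aux2 y (r.trans h5 (r.symm h4)) ⟨h2, h3⟩
    · exact absurd hxz.1 hxin

theorem IsNoncrossing.join_succ {r : Setoid (Fin m)} (hr : IsNoncrossing r) {a b : Fin m}
    (h : (a : ℕ) + 1 = b) : IsNoncrossing (ParkingPoset.join r a b) := by
  refine hr.join fun c d hcd ha hb _ => ?_
  have h1 : c ≠ a := fun h' => ha (h' ▸ r.refl c)
  have h2 : c ≠ b := fun h' => hb (h' ▸ r.refl c)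
  have h3 : d ≠ a := fun h' => ha (h' ▸ hcd)
  have h4 : d ≠ b := fun h' => hb (h' ▸ hcd)
  simp only [ne_eq, Fin.ext_iff, Fin.lt_def] at *
  omega

/-- Every covering relation with a label joins two blocks. -/
theorem exists_isMerge_of_isEdgeLabel {p q : NC m} {ℓ : ℕ} (hpq : p ⋖ q)
    (h : IsEdgeLabel p q ℓ) :
    ∃ x y, IsMerge p.1 q.1 x ∧ IsPred q.1 y x ∧ ℓ = y + 1 := by
  obtain ⟨B₁, ⟨a, rfl⟩, B₂, ⟨b, rfl⟩, hne, ⟨e, he⟩, ⟨w, hw, hmin⟩, y, hy, rfl⟩ := h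
  have hq : ∀ z, q.1 z e ↔ p.1 z a ∨ p.1 z b := fun z => by
    have : z ∈ {x | q.1 x e} ↔ z ∈ {x | p.1 x a} ∪ {x | p.1 x b} := by rw [he]
    simpa using this
  obtain ⟨x, hx, hmx, -⟩ := exists_blockMin p.1 b
  have hyx : y < x := hy.1.2 x hx
  have hya : p.1 y a := hy.1.1
  have hjoin : IsMerge p.1 (join p.1 y x) x := isMerge_join hmx hyx
  have hjr : ∀ s t, join p.1 y x s t ↔ p.1 s t ∨ (q.1 s e ∧ q.1 t e) := by
    intro s t
    have h1 : ∀ s, (p.1 s y ∨ p.1 s x) ↔ (p.1 s a ∨ p.1 s b) := fun s =>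
      or_congr ⟨fun h => p.1.trans h hya, fun h => p.1.trans h (p.1.symm hya)⟩
        ⟨fun h => p.1.trans h hx, fun h => p.1.trans h (p.1.symm hx)⟩
    rw [join_rel, h1, h1, hq, hq]
  have hnc : IsNoncrossing (join p.1 y x) := by
    intro s t u v h1 h2 h3 hsu htv
    rw [hjr] at hsu htv ⊢
    have hle : p.1 ≤ q.1 := hpq.le
    rcases hsu with hsu | hsu <;> rcases htv with htv | htv
    · exact .inl (p.2 s t u v h1 h2 h3 hsu htv)
    · exact .inr ⟨q.1.trans (q.2 s t u v h1 h2 h3 (hle hsu)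
        (q.1.trans htv.1 (q.1.symm htv.2))) htv.1, htv.1⟩
    · exact .inr ⟨hsu.1, q.1.trans (q.1.symm (q.2 s t u v h1 h2 h3
        (q.1.trans hsu.1 (q.1.symm hsu.2)) (hle htv))) hsu.1⟩
    · exact .inr ⟨hsu.1, htv.1⟩
  have hle : (⟨join p.1 y x, hnc⟩ : NC m) ≤ q := by
    intro s t hst
    rcases (hjr s t).1 hst with h | h
    · exact hpq.le h
    · exact q.1.trans h.1 (q.1.symm h.2)
  have heq : (⟨join p.1 y x, hnc⟩ : NC m) = q :=
    (hpq.eq_or_eq hjoin.le hle).resolve_left fun h => hjoin.lt.ne (congrArg Subtype.val h).symm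
  have heq' : join p.1 y x = q.1 := congrArg Subtype.val heq
  rw [heq'] at hjoin
  refine ⟨x, y, hjoin, ⟨hyx, heq' ▸ join_rel_self _ _ _, fun z hz hzx => hy.2 ⟨?_, ?_⟩⟩, rfl⟩
  · have hxe : q.1 x e := (hq x).2 (.inr hx)
    refine ((hq z).1 (q.1.trans hz hxe)).resolve_right fun h1 => ?_
    exact absurd (hmx z (p.1.trans hx (p.1.symm h1))) (not_le.2 hzx)
  · exact fun t ht => hzx.trans_le (hmx t (p.1.trans hx (p.1.symm ht)))

end

/-! ### Arcs and free points -/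

section
variable {n : ℕ} {v : Fin (n + 1)}

/-- `(a, b)` is an arc of `r` below `v`: `a ≠ 0` is the least element of a block, and `b ≠ a` is
the largest element of this block that does not exceed `v`. -/
structure IsArc (v : Fin (n + 1)) (r : Setoid (Fin (n + 1))) (a b : Fin (n + 1)) : Prop where
  ne_zero : a ≠ 0
  min : IsBlockMin r a
  lt : a < b
  le : b ≤ v
  rel : r a b
  max : ∀ z, r a z → z ≤ v → z ≤ b

/-- Beyond `v`, each point is the minimum of its block or lies in the block of its predecessor. -/
def HasLinearTail (v : Fin (n + 1)) (r : Setoid (Fin (n + 1))) : Prop :=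
  ∀ w y : Fin (n + 1), v < y → (w : ℕ) + 1 = y → ¬ IsBlockMin r y → r w y

open Classical in
/-- The nonzero points that are not endpoints of an arc. -/
noncomputable def free (A : Fin (n + 1) → Fin (n + 1) → Prop) : Finset (Fin (n + 1)) :=
  Finset.univ.filter fun x => x ≠ 0 ∧ ∀ b, ¬ A x b ∧ ¬ A b x

open Classical in
/-- The free points that are not the minimum of their block. -/
noncomputable def absorbed (v : Fin (n + 1)) (r : Setoid (Fin (n + 1))) : Finset (Fin (n + 1)) :=
  (free (IsArc v r)).filter fun x => ¬ IsBlockMin r x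

theorem mem_free {A : Fin (n + 1) → Fin (n + 1) → Prop} {x : Fin (n + 1)} :
    x ∈ free A ↔ x ≠ 0 ∧ ∀ b, ¬ A x b ∧ ¬ A b x := by
  classical
  simp [free]

theorem mem_absorbed {r : Setoid (Fin (n + 1))} {x : Fin (n + 1)} :
    x ∈ absorbed v r ↔ x ∈ free (IsArc v r) ∧ ¬ IsBlockMin r x := by
  classical
  simp [absorbed]

theorem absorbed_subset (r : Setoid (Fin (n + 1))) : absorbed v r ⊆ free (IsArc v r) :=
  fun _ h => (mem_absorbed.1 h).1

theorem isBlockMin_zero (r : Setoid (Fin (n + 1))) : IsBlockMin r 0 := fun _ _ => Fin.zero_le _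

theorem exists_prev (z : Fin (n + 1)) (h : v < z) : ∃ w : Fin (n + 1), (w : ℕ) + 1 = z := by
  have := Fin.lt_def.1 h
  exact ⟨⟨z - 1, by omega⟩, Nat.sub_add_cancel (by omega)⟩

theorem exists_isArc {r : Setoid (Fin (n + 1))} {a z : Fin (n + 1)} (h0 : a ≠ 0)
    (ha : IsBlockMin r a) (haz : r a z) (hz : z ≤ v) (hlt : a < z) :
    ∃ b, IsArc v r a b ∧ z ≤ b := by
  obtain ⟨b, hb, hm⟩ := wellFounded_gt.has_min {y | r a y ∧ y ≤ v} ⟨z, haz, hz⟩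
  have hzb : z ≤ b := not_lt.1 (hm z ⟨haz, hz⟩)
  exact ⟨b, ⟨h0, ha, hlt.trans_le hzb, hb.2, hb.1, fun y h1 h2 => not_lt.1 (hm y ⟨h1, h2⟩)⟩, hzb⟩

theorem IsArc.right_unique {r : Setoid (Fin (n + 1))} {a b b' : Fin (n + 1)} (h : IsArc v r a b)
    (h' : IsArc v r a b') : b = b' :=
  le_antisymm (h'.max _ h.rel h.le) (h.max _ h'.rel h'.le)

theorem IsArc.left_unique {r : Setoid (Fin (n + 1))} {a a' b : Fin (n + 1)} (h : IsArc v r a b)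
    (h' : IsArc v r a' b) : a = a' :=
  h.min.eq h'.min (r.trans h.rel (r.symm h'.rel))

theorem IsArc.not_isBlockMin {r : Setoid (Fin (n + 1))} {a b : Fin (n + 1)} (h : IsArc v r a b) :
    ¬ IsBlockMin r b := fun h' => h.lt.ne (h.min.eq h' h.rel)

theorem isBlockMin_iff {r : Setoid (Fin (n + 1))} {x : Fin (n + 1)} :
    IsBlockMin r x ↔
      x = 0 ∨ (∃ b, IsArc v r x b) ∨ (x ∈ free (IsArc v r) ∧ x ∉ absorbed v r) := by
  constructor
  · intro h
    by_cases h0 : x = 0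
    · exact .inl h0
    by_cases h1 : ∃ b, IsArc v r x b
    · exact .inr (.inl h1)
    push Not at h1
    exact .inr (.inr ⟨mem_free.2 ⟨h0, fun b => ⟨h1 b, fun hb => hb.not_isBlockMin h⟩⟩,
      fun h2 => (mem_absorbed.1 h2).2 h⟩)
  · rintro (rfl | ⟨b, hb⟩ | ⟨h1, h2⟩)
    · exact isBlockMin_zero r
    · exact hb.min
    · by_contra h3
      exact h2 (mem_absorbed.2 ⟨h1, h3⟩)

theorem not_isBlockMin_iff {r : Setoid (Fin (n + 1))} {x : Fin (n + 1)} :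
    ¬ IsBlockMin r x ↔ (∃ a, IsArc v r a x) ∨ x ∈ absorbed v r := by
  constructor
  · intro h
    by_cases hx : x ∈ free (IsArc v r)
    · exact .inr (mem_absorbed.2 ⟨hx, h⟩)
    · left
      rw [mem_free] at hx
      push Not at hx
      obtain ⟨b, hb⟩ := hx (fun h0 => h (h0 ▸ isBlockMin_zero r))
      by_cases h1 : IsArc v r x b
      · exact absurd h1.min h
      · exact ⟨b, hb h1⟩
  · rintro (⟨a, ha⟩ | h)
    · exact ha.not_isBlockMin
    · exact (mem_absorbed.1 h).2

/-- A free point up to `v` that is not the minimum of its block lies in the block of `0` or under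
the arc of its block. -/
theorem lt_of_mem_free {r : Setoid (Fin (n + 1))} {y x : Fin (n + 1)}
    (hx : x ∈ free (IsArc v r)) (hxv : x ≤ v) (hy : IsBlockMin r y) (hyx : r y x) (hlt : y < x) :
    y = 0 ∨ ∃ c, IsArc v r y c ∧ x < c := by
  by_cases h0 : y = 0
  · exact .inl h0
  · obtain ⟨c, hc, hxc⟩ := exists_isArc h0 hy hyx hxv hlt
    exact .inr ⟨c, hc, lt_of_le_of_ne hxc fun h => ((mem_free.1 hx).2 y).2 (h ▸ hc)⟩

/-- A noncrossing partition with linear tail is determined by its arcs and by the free points that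
are not block minima: such a point `x ≤ v` belongs to the innermost arc around it. -/
theorem eq_of_isArc_eq {p q : Setoid (Fin (n + 1))} (hp : IsNoncrossing p) (hq : IsNoncrossing q)
    (hpt : HasLinearTail v p) (hqt : HasLinearTail v q) (hA : IsArc v p = IsArc v q)
    (hS : absorbed v p = absorbed v q) : p = q := by
  have hmin : ∀ x, IsBlockMin p x ↔ IsBlockMin q x := fun x => by
    rw [isBlockMin_iff (v := v), isBlockMin_iff (v := v) (r := q), hA, hS]
  have key : ∀ x y, IsBlockMin p y → p y x → q y x := by
    intro x
    induction x using WellFoundedLT.induction with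
    | ind x ih =>
      intro y hy hyx
      by_cases hx : IsBlockMin p x
      · rw [hy.eq hx hyx]
      have hlt : y < x := lt_of_le_of_ne (hy x hyx) fun h => hx (h ▸ hy)
      rcases (not_isBlockMin_iff (v := v)).1 hx with ⟨a, ha⟩ | hxS
      · have : y = a := hy.eq ha.min (p.trans hyx (p.symm ha.rel))
        rw [hA] at ha
        exact this ▸ ha.rel
      · rcases le_or_gt x v with hxv | hxv
        · obtain ⟨y', hy'x, hy', hle⟩ := exists_blockMin q x
          have hlt' : y' < x := lt_of_le_of_ne hle fun h => hx ((hmin x).2 (h ▸ hy'))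
          have hf := (mem_absorbed.1 hxS).1
          have h1 := lt_of_mem_free hf hxv hy hyx hlt
          have h2 := lt_of_mem_free (hA ▸ hf) hxv hy' hy'x hlt'
          have hyy : y = y' := by
            rcases lt_trichotomy y y' with h | h | h
            · rcases h2 with rfl | ⟨c, hc, hxc⟩
              · exact absurd h (Fin.not_lt_zero y)
              · rw [← hA] at hc
                exact hy.eq hc.min (hp y y' x c h hlt' hxc hyx hc.rel)
            · exact h
            · rcases h1 with rfl | ⟨c, hc, hxc⟩
              · exact absurd h (Fin.not_lt_zero y')
              · rw [hA] at hc
                exact (hy'.eq hc.min (hq y' y x c h hlt hxc hy'x hc.rel)).symm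
          exact hyy ▸ hy'x
        · obtain ⟨w, hw⟩ := exists_prev x hxv
          have hwx : w < x := Fin.lt_def.2 (by omega)
          have h1 := hpt w x hxv hw hx
          have h2 := hqt w x hxv hw fun h => hx ((hmin x).2 h)
          exact q.trans (ih w hwx y hy (p.trans hyx (p.symm h1))) h2
  refine eq_of_le_of_blockMin (fun a b hab => ?_) fun x => (hmin x).1
  obtain ⟨y, hy, hm, -⟩ := exists_blockMin p a
  exact q.trans (q.symm (key a y hm hy)) (key b y hm (p.trans hy hab))

theorem IsMerge.absorbed_eq {p q : Setoid (Fin (n + 1))} {x : Fin (n + 1)} (h : IsMerge p q x)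
    (hA : IsArc v q = IsArc v p) (hx : x ∈ free (IsArc v p)) :
    x ∉ absorbed v p ∧ absorbed v q = insert x (absorbed v p) := by
  refine ⟨fun h' => (mem_absorbed.1 h').2 h.min, ?_⟩
  ext y
  rw [Finset.mem_insert, mem_absorbed, mem_absorbed, hA]
  by_cases hy : y = x
  · subst hy; simp [hx, h.not_min]
  · simp only [hy, false_or]
    exact and_congr_right fun _ =>
      ⟨fun h1 h2 => h1 (h.min_of_ne y hy h2), fun h1 h2 => h1 (h2.anti h.le)⟩

/-- The partition that splits each block into its parts inside and outside `I`. -/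
def cut (r : Setoid (Fin (n + 1))) (I : Set (Fin (n + 1))) : Setoid (Fin (n + 1)) where
  r x y := r x y ∧ (x ∈ I ↔ y ∈ I)
  iseqv := ⟨fun x => ⟨r.refl x, Iff.rfl⟩, fun h => ⟨r.symm h.1, h.2.symm⟩,
    fun h h' => ⟨r.trans h.1 h'.1, h.2.trans h'.2⟩⟩

theorem IsNoncrossing.cut {r : Setoid (Fin (n + 1))} (hr : IsNoncrossing r)
    {I : Set (Fin (n + 1))} (hI : I.OrdConnected) : IsNoncrossing (cut r I) := by
  rintro a b c d h1 h2 h3 ⟨hac, hac'⟩ ⟨hbd, hbd'⟩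
  refine ⟨hr a b c d h1 h2 h3 hac hbd, fun ha => ?_, fun hb => ?_⟩
  · exact hI.out ha (hac'.1 ha) ⟨h1.le, h2.le⟩
  · exact hac'.2 (hI.out hb (hbd'.1 hb) ⟨h2.le, h3.le⟩)

/-- A free point that is not the minimum of its block can be split off, together with the points
beyond `v` that follow it if `v ≤ x`. -/
theorem exists_remove {r : Setoid (Fin (n + 1))} (hr : IsNoncrossing r) (ht : HasLinearTail v r)
    {x : Fin (n + 1)} (hx : x ∈ absorbed v r) :
    ∃ r', IsNoncrossing r' ∧ HasLinearTail v r' ∧ IsArc v r' = IsArc v r ∧ IsMerge r' r x := by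
  let I : Set (Fin (n + 1)) := {z | z = x ∨ (v ≤ x ∧ x ≤ z)}
  have hIx : ∀ z, z ∈ I ↔ z = x ∨ (v ≤ x ∧ x ≤ z) := fun z => Iff.rfl
  have hIc : I.OrdConnected := by
    refine ⟨fun a ha b hb c hc => ?_⟩
    rw [hIx] at *
    obtain ⟨h1, h2⟩ := hc
    simp only [Fin.ext_iff, Fin.le_def] at *
    omega
  have hxI : x ∈ I := .inl rfl
  have hle : ∀ z, z ∈ I → x ≤ z := by
    rintro z (rfl | h)
    · exact le_rfl
    · exact h.2
  have hIv : ∀ z, z ≤ v → z ≠ x → z ∉ I := by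
    rintro z h1 h2 (h | h)
    · exact h2 h
    · exact h2 (le_antisymm (h1.trans h.1) h.2)
  obtain ⟨hxf, hxm⟩ := mem_absorbed.1 hx
  have hrr : cut r I ≤ r := fun a b h => h.1
  have pred : ∀ w y : Fin (n + 1), v < y → (w : ℕ) + 1 = y → y ≠ x → (w ∈ I ↔ y ∈ I) := by
    intro w y h1 h2 h3
    rw [hIx, hIx]
    simp only [Fin.ext_iff, Fin.le_def, Fin.lt_def, ne_eq] at *
    omega
  have hmerge : IsMerge (cut r I) r x := by
    refine ⟨hrr, fun z hz => hle z (hz.2.1 hxI), hxm, fun y hyx hy => ?_⟩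
    by_contra hn
    by_cases hyI : y ∈ I
    · have hvy : v < y := by
        rcases hyI with h | h
        · exact absurd h hyx
        · exact h.1.trans_lt (lt_of_le_of_ne h.2 (Ne.symm hyx))
      obtain ⟨w, hw⟩ := exists_prev y hvy
      have h1 : cut r I y w := ⟨r.symm (ht w y hvy hw hn), (pred w y hvy hw hyx).symm⟩
      have := Fin.le_def.1 (hy w h1)
      omega
    · obtain ⟨z, hz, hzm, hzy⟩ := exists_blockMin r y
      have hzI : z ∉ I := by
        intro h
        rcases h with h | h
        · exact hxm (h ▸ hzm)
        · exact hyI (.inr ⟨h.1, h.2.trans hzy⟩)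
      have : y ≤ z := hy z ⟨r.symm hz, by simp [hyI, hzI]⟩
      exact hn (le_antisymm this hzy ▸ hzm)
  refine ⟨cut r I, hr.cut hIc, ?_, ?_, hmerge⟩
  · intro w y h1 h2 h3
    have hyx : y ≠ x := fun h => h3 (h ▸ hmerge.min)
    exact ⟨ht w y h1 h2 fun h => h3 (h.anti hrr), pred w y h1 h2 hyx⟩
  · funext a b
    refine propext ⟨fun h => ?_, fun h => ?_⟩
    · have hax : a ≠ x := by
        rintro rfl
        have h1 := h.rel.2.1 hxI
        exact hIv b h.le h.lt.ne' h1
      have ham := hmerge.min_of_ne a hax h.min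
      obtain ⟨c, hc, hbc⟩ := exists_isArc h.ne_zero ham h.rel.1 h.le h.lt
      have hcx : c ≠ x := fun h' => ((mem_free.1 hxf).2 a).2 (h' ▸ hc)
      have haI := hIv a (h.lt.le.trans h.le) hax
      have hcb : c ≤ b := h.max c ⟨hc.rel, by simp [haI, hIv c hc.le hcx]⟩ hc.le
      exact le_antisymm hbc hcb ▸ hc
    · have hax : a ≠ x := fun h' => hxm (h' ▸ h.min)
      have hbx : b ≠ x := fun h' => ((mem_free.1 hxf).2 a).2 (h' ▸ h)
      exact ⟨h.ne_zero, h.min.anti hrr, h.lt, h.le,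
        ⟨h.rel, by simp [hIv a (h.lt.le.trans h.le) hax, hIv b h.le hbx]⟩,
        fun z hz => h.max z hz.1⟩

/-- A free point that is the minimum of its block can be absorbed: beyond `v` by the block of its
predecessor, otherwise by the block of the innermost arc around it or, if there is none, by the
block of `0`. -/
theorem exists_add {r : Setoid (Fin (n + 1))} (hr : IsNoncrossing r) (ht : HasLinearTail v r)
    {x : Fin (n + 1)} (hxf : x ∈ free (IsArc v r)) (hxm : IsBlockMin r x) :
    ∃ r', IsNoncrossing r' ∧ HasLinearTail v r' ∧ IsArc v r' = IsArc v r ∧ IsMerge r r' x := by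
  have hx0 : x ≠ 0 := (mem_free.1 hxf).1
  have hx0' : 0 < x := Fin.pos_of_ne_zero hx0
  -- up to `v`, the point `x` is alone in its block
  have hsing : ∀ z, r z x → z ≤ v → z = x := by
    intro z hz hzv
    by_contra hne
    obtain ⟨b, hb, -⟩ := exists_isArc hx0 hxm (r.symm hz) hzv
      (lt_of_le_of_ne (hxm z (r.symm hz)) (Ne.symm hne))
    exact ((mem_free.1 hxf).2 b).1 hb
  obtain ⟨w, hwx, hnc, htail, hpar⟩ : ∃ w, w < x ∧ IsNoncrossing (join r w x) ∧
      (v < x → (w : ℕ) + 1 = x) ∧ (x ≤ v → w = 0 ∨ ∃ c, IsArc v r w c ∧ x < c) := by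
    rcases le_or_gt x v with hxv | hxv
    · -- `w` is the left end of the innermost arc around `x`
      obtain ⟨w, ⟨hwx, hw⟩, hmax⟩ := wellFounded_gt.has_min
        {w | w < x ∧ (w = 0 ∨ ∃ c, IsArc v r w c ∧ x < c)} ⟨0, hx0', .inl rfl⟩
      have hmax' : ∀ a c, IsArc v r a c → a < x → x < c → a ≤ w := fun a c h1 h2 h3 =>
        not_lt.1 (hmax a ⟨h2, .inr ⟨c, h1, h3⟩⟩)
      have hwm : IsBlockMin r w := by
        rcases hw with rfl | ⟨c, hc, -⟩
        · exact isBlockMin_zero r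
        · exact hc.min
      refine ⟨w, hwx, ?_, fun h => absurd h (not_lt.2 hxv), fun _ => hw⟩
      refine hr.join fun b d hbd hbw hbx hlt => ⟨fun h => ⟨h.1.trans hwx, ?_⟩, fun h => ⟨?_, ?_⟩⟩
      · rcases hw with rfl | ⟨c, hc, hxc⟩
        · exact absurd h.1 (Fin.not_lt_zero b)
        · by_contra hd
          have hdx : d < x := lt_of_le_of_ne (not_lt.1 hd) fun h' => hbx (h' ▸ hbd)
          exact hbw (hr b w d c h.1 h.2 (hdx.trans hxc) hbd hc.rel)
      · -- the arc of the block of `b` contains `x`, hence lies outside `w`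
        by_contra hwb
        have hwb' : w < b := lt_of_le_of_ne (not_lt.1 hwb) fun h' => hbw (h' ▸ r.refl b)
        obtain ⟨e, heb, hem, hle⟩ := exists_blockMin r b
        -- some point of the block of `b` lies strictly between `x` and `v`
        have hd' : ∃ d', r b d' ∧ x < d' ∧ d' ≤ v := by
          by_contra hno
          push Not at hno
          have hall : ∀ N : ℕ, ∀ y : Fin (n + 1), (y : ℕ) = N → r b y → ¬ x < y := by
            intro N
            induction N with
            | zero => intro y hy _ h1; have := Fin.lt_def.1 h1; omega
            | succ N ih =>
              intro y hy hby h1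
              have hvy := hno y hby h1
              let t : Fin (n + 1) := ⟨N, by omega⟩
              have hty : (t : ℕ) + 1 = y := hy.symm
              have hbt : r b t := r.trans hby (r.symm (ht t y hvy hty fun hm =>
                absurd (hm b (r.symm hby)) (not_le.2 (h.1.trans h1))))
              have htx : t ≠ x := fun h' => hbx (h' ▸ hbt)
              refine ih t rfl hbt (lt_of_le_of_ne ?_ (Ne.symm htx))
              have := Fin.lt_def.1 h1
              exact Fin.le_def.2 (by omega)
          exact hall d d rfl hbd h.2
        obtain ⟨d', hbd', hxd', hdv'⟩ := hd'
        have hew : e ≠ w := fun h' => hbw (r.symm (h' ▸ heb))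
        by_cases he0 : e = 0
        · rcases hw with hw0 | ⟨c, hc, hxc⟩
          · exact hew (he0.trans hw0.symm)
          · have h0w : 0 < w := Fin.pos_of_ne_zero hc.ne_zero
            have h1 := hr 0 w b c h0w hwb' (h.1.trans hxc) (he0 ▸ heb) hc.rel
            exact absurd ((hwm 0 (r.symm h1))) (not_le.2 h0w)
        · obtain ⟨c', hc', hdc'⟩ := exists_isArc he0 hem (r.trans heb hbd') hdv'
            (hle.trans_lt (h.1.trans hxd'))
          have h1 := hmax' e c' hc' (hle.trans_lt h.1) (hxd'.trans_le hdc')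
          have h2 : e < w := lt_of_le_of_ne h1 hew
          rcases hw with hw0 | ⟨c, hc, hxc⟩
          · rw [hw0] at h2
            exact absurd h2 (Fin.not_lt_zero e)
          · have h3 := hr e w b c h2 hwb' (h.1.trans hxc) heb hc.rel
            exact hew (hem.eq hwm h3)
      · exact hwx.trans h.2
    · obtain ⟨w, hw⟩ := exists_prev x hx0'
      exact ⟨w, Fin.lt_def.2 (by omega), hr.join_succ hw, fun _ => hw,
        fun h => absurd hxv (not_lt.2 h)⟩
  have hm : IsMerge r (join r w x) x := isMerge_join hxm hwx
  refine ⟨join r w x, hnc, ?_, ?_, hm⟩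
  · intro s y h1 h2 h3
    by_cases hyx : y = x
    · subst hyx
      have : s = w := Fin.ext (by have := htail h1; omega)
      exact this ▸ join_rel_self r w y
    · exact hm.le (ht s y h1 h2 fun h => h3 (hm.min_of_ne y hyx h))
  · funext a b
    refine propext ⟨fun h => ?_, fun h => ?_⟩
    · have hax : a ≠ x := fun h' => hm.not_min (h' ▸ h.min)
      have ham := h.min.anti hm.le
      have hrab : r a b := by
        rcases h.rel with h1 | ⟨h1 | h1, h2 | h2⟩
        · exact h1
        · exact r.trans h1 (r.symm h2)
        · exfalso
          have hbx := hsing b h2 h.le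
          subst hbx
          rcases hpar h.le with h3 | ⟨c, hc, hxc⟩
          · subst h3
            exact h.ne_zero (ham.eq (isBlockMin_zero r) h1)
          · have haw : a = w := ham.eq hc.min h1
            subst haw
            exact absurd (h.max c (hm.le hc.rel) hc.le) (not_le.2 hxc)
        · exact absurd (ham.eq hxm h1) hax
        · exact absurd (ham.eq hxm h1) hax
      exact ⟨h.ne_zero, ham, h.lt, h.le, hrab, fun z hz => h.max z (hm.le hz)⟩
    · have hax : a ≠ x := fun h' => ((mem_free.1 hxf).2 b).1 (h' ▸ h)
      refine ⟨h.ne_zero, hm.min_of_ne a hax h.min, h.lt, h.le, hm.le h.rel, fun z hz hzv => ?_⟩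
      rcases hz with h1 | ⟨h1 | h1, h2 | h2⟩
      · exact h.max z h1 hzv
      · exact h.max z (r.trans h1 (r.symm h2)) hzv
      · have hzx := hsing z h2 hzv
        subst hzx
        rcases hpar hzv with h3 | ⟨c, hc, hxc⟩
        · subst h3
          exact absurd (h.min.eq (isBlockMin_zero r) h1) h.ne_zero
        · have haw : a = w := h.min.eq hc.min h1
          subst haw
          rw [h.right_unique hc]
          exact hxc.le
      · exact absurd (h.min.eq hxm h1) hax
      · exact absurd (h.min.eq hxm h1) hax

/-- Given the arcs, the set of free points that are not block minima can be prescribed. -/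
theorem exists_absorbed_eq {r : Setoid (Fin (n + 1))} (hr : IsNoncrossing r)
    (ht : HasLinearTail v r) (S : Finset (Fin (n + 1))) (hS : S ⊆ free (IsArc v r)) :
    ∃ r', IsNoncrossing r' ∧ HasLinearTail v r' ∧ IsArc v r' = IsArc v r ∧ absorbed v r' = S := by
  have empty : ∀ N, ∀ p : Setoid (Fin (n + 1)), IsNoncrossing p → HasLinearTail v p →
      IsArc v p = IsArc v r → (absorbed v p).card = N →
      ∃ r', IsNoncrossing r' ∧ HasLinearTail v r' ∧ IsArc v r' = IsArc v r ∧
        absorbed v r' = ∅ := by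
    intro N
    induction N with
    | zero => intro p h1 h2 h3 h4; exact ⟨p, h1, h2, h3, Finset.card_eq_zero.1 h4⟩
    | succ N ih =>
      intro p h1 h2 h3 h4
      obtain ⟨x, hx⟩ := Finset.card_pos.1 (by omega : 0 < (absorbed v p).card)
      obtain ⟨p', h1', h2', h3', hm⟩ := exists_remove h1 h2 hx
      obtain ⟨hn, he⟩ := hm.absorbed_eq (v := v) h3'.symm (h3' ▸ (mem_absorbed.1 hx).1)
      refine ih p' h1' h2' (h3'.trans h3) ?_
      rw [he, Finset.card_insert_of_notMem hn] at h4
      omega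
  induction S using Finset.induction_on with
  | empty => exact empty _ r hr ht rfl rfl
  | insert x S hx ih =>
    rw [Finset.insert_subset_iff] at hS
    obtain ⟨p, h1, h2, h3, h4⟩ := ih hS.2
    have hxf : x ∈ free (IsArc v p) := h3 ▸ hS.1
    have hxm : IsBlockMin p x := by
      by_contra h
      exact hx (h4 ▸ mem_absorbed.2 ⟨hxf, h⟩)
    obtain ⟨q, h1', h2', h3', hm⟩ := exists_add h1 h2 hxf hxm
    exact ⟨q, h1', h2', h3'.trans h3, h4 ▸ (hm.absorbed_eq h3' hxf).2⟩

open Classical in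
/-- The left endpoints of arcs. -/
noncomputable def openers (A : Fin (n + 1) → Fin (n + 1) → Prop) : Finset (Fin (n + 1)) :=
  Finset.univ.filter fun x => ∃ b, A x b

/-- There are as many right endpoints of arcs as left endpoints. -/
theorem card_closers (r : Setoid (Fin (n + 1))) [DecidablePred fun x => ∃ a, IsArc v r a x] :
    (Finset.univ.filter fun x => ∃ a, IsArc v r a x).card = (openers (IsArc v r)).card := by
  classical
  refine Finset.card_bij (fun x hx => (Finset.mem_filter.1 hx).2.choose) ?_ ?_ ?_
  · intro x hx
    exact Finset.mem_filter.2 ⟨Finset.mem_univ _, x, (Finset.mem_filter.1 hx).2.choose_spec⟩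
  · intro x hx y hy h
    exact (Finset.mem_filter.1 hx).2.choose_spec.right_unique
      (h ▸ (Finset.mem_filter.1 hy).2.choose_spec)
  · intro a ha
    obtain ⟨b, hb⟩ := (Finset.mem_filter.1 ha).2
    have hb' : b ∈ Finset.univ.filter fun x => ∃ a, IsArc v r a x :=
      Finset.mem_filter.2 ⟨Finset.mem_univ _, a, hb⟩
    exact ⟨b, hb', (Finset.mem_filter.1 hb').2.choose_spec.left_unique hb⟩

theorem rank_eq (r : Setoid (Fin (n + 1))) :
    rank r = (openers (IsArc v r)).card + (absorbed v r).card := by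
  classical
  rw [← card_closers, ← Finset.card_union_of_disjoint]
  · unfold rank
    congr 1
    ext x
    simp [not_isBlockMin_iff (v := v)]
  · rw [Finset.disjoint_left]
    intro x hx hx'
    obtain ⟨a, ha⟩ := (Finset.mem_filter.1 hx).2
    exact ((mem_free.1 (absorbed_subset r hx')).2 a).2 ha

theorem card_free (r : Setoid (Fin (n + 1))) :
    2 * (openers (IsArc v r)).card + (free (IsArc v r)).card = n := by
  classical
  have h1 : (Finset.univ.filter fun x => ∃ a, IsArc v r a x) ∪ openers (IsArc v r) ∪
      free (IsArc v r) = Finset.univ.erase 0 := by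
    ext x
    simp only [Finset.mem_union, openers, Finset.mem_filter, Finset.mem_univ, true_and, mem_free,
      Finset.mem_erase, and_true]
    constructor
    · rintro ((⟨a, ha⟩ | ⟨b, hb⟩) | h)
      · exact fun h => ha.not_isBlockMin (h ▸ isBlockMin_zero r)
      · exact hb.ne_zero
      · exact h.1
    · intro h0
      by_contra hn
      push Not at hn
      obtain ⟨b, hb⟩ := hn.2 h0
      exact hn.1.1 b (hb (hn.1.2 b))
  have h2 : Disjoint (Finset.univ.filter fun x => ∃ a, IsArc v r a x) (openers (IsArc v r)) := by
    rw [Finset.disjoint_left]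
    intro x hx hx'
    obtain ⟨a, ha⟩ := (Finset.mem_filter.1 hx).2
    obtain ⟨b, hb⟩ := (Finset.mem_filter.1 hx').2
    exact ha.not_isBlockMin hb.min
  have h3 : Disjoint ((Finset.univ.filter fun x => ∃ a, IsArc v r a x) ∪ openers (IsArc v r))
      (free (IsArc v r)) := by
    rw [Finset.disjoint_left]
    intro x hx hx'
    rcases Finset.mem_union.1 hx with hx | hx
    · obtain ⟨a, ha⟩ := (Finset.mem_filter.1 hx).2
      exact ((mem_free.1 hx').2 a).2 ha
    · obtain ⟨b, hb⟩ := (Finset.mem_filter.1 hx).2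
      exact ((mem_free.1 hx').2 b).1 hb
  have h4 := congrArg Finset.card h1
  rw [Finset.card_union_of_disjoint h3, Finset.card_union_of_disjoint h2, card_closers,
    Finset.card_erase_of_mem (Finset.mem_univ _), Finset.card_univ, Fintype.card_fin] at h4
  omega

end

/-! ### Admissible partitions -/

section
variable {n : ℕ} {u v : Fin (n + 1)}

/-- The partitions that will turn out to be the elements of `Poset(PF_{n,k})`, where `v` stands
for the number `k + 1` and `u` for its predecessor `k`. The condition on the arc `(u, v)` says that
`{u, v}` is not the part up to `v` of a block. -/
structure Admissible (u v : Fin (n + 1)) (r : Setoid (Fin (n + 1))) : Prop where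
  noncrossing : IsNoncrossing r
  tail : HasLinearTail v r
  not_isArc : ¬ IsArc v r u v
  imp : r 0 u → r 0 v

/-- `q` arises from `p` by joining two blocks, and the label is not the number `u + 1`, that is, not
`v` joined to the block of `u`. -/
def IsAdmissibleMerge (u v : Fin (n + 1)) (p q : NC (n + 1)) : Prop :=
  ∃ x, IsMerge p.1 q.1 x ∧ ¬ (x = v ∧ q.1 u v)

theorem isArc_succ_iff (huv : (u : ℕ) + 1 = v) (hu : u ≠ 0) {r : Setoid (Fin (n + 1))} :
    IsArc v r u v ↔ IsBlockMin r u ∧ r u v :=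
  ⟨fun h => ⟨h.min, h.rel⟩, fun h => ⟨hu, h.1, Fin.lt_def.2 (by omega), le_rfl, h.2,
    fun _ _ h => h⟩⟩

theorem mem_absorbed_of_rel_zero {r : Setoid (Fin (n + 1))} {x : Fin (n + 1)} (hx : x ≠ 0)
    (h : r 0 x) : x ∈ absorbed v r := by
  have hm : ¬ IsBlockMin r x := fun h' => hx ((isBlockMin_zero r).eq h' h).symm
  refine mem_absorbed.2 ⟨mem_free.2 ⟨hx, fun b => ⟨fun h' => hm h'.min, fun h' => ?_⟩⟩, hm⟩
  exact h'.ne_zero (h'.min.eq (isBlockMin_zero r) (r.trans h'.rel (r.symm h)))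

theorem rel_zero_of_mem_absorbed {r : Setoid (Fin (n + 1))} (h : v ∈ absorbed v r) : r 0 v := by
  obtain ⟨hf, hm⟩ := mem_absorbed.1 h
  obtain ⟨a, ha, ham, hle⟩ := exists_blockMin r v
  have hlt : a < v := lt_of_le_of_ne hle fun h' => hm (h' ▸ ham)
  rcases lt_of_mem_free hf le_rfl ham ha hlt with h0 | ⟨c, hc, hvc⟩
  · exact h0 ▸ ha
  · exact absurd hc.le (not_le.2 hvc)

/-- If `0` is in the block of `u`, then no arc ends at `v`, since it would cross that block. -/
theorem imp_iff (huv : (u : ℕ) + 1 = v) (hu : u ≠ 0) {r : Setoid (Fin (n + 1))}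
    (hr : IsNoncrossing r) :
    (r 0 u → r 0 v) ↔
      (u ∈ free (IsArc v r) → v ∈ free (IsArc v r) → u ∈ absorbed v r → v ∈ absorbed v r) := by
  have huv' : u < v := Fin.lt_def.2 (by omega)
  have hv : v ≠ 0 := fun h => Fin.not_lt_zero u (h ▸ huv')
  constructor
  · intro h _ hvf hua
    refine mem_absorbed_of_rel_zero hv (h ?_)
    obtain ⟨hf, hm⟩ := mem_absorbed.1 hua
    obtain ⟨a, ha, ham, hle⟩ := exists_blockMin r u
    have hlt : a < u := lt_of_le_of_ne hle fun h' => hm (h' ▸ ham)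
    rcases lt_of_mem_free hf huv'.le ham ha hlt with h0 | ⟨c, hc, huc⟩
    · exact h0 ▸ ha
    · have hcv : c = v := by
        have := Fin.le_def.1 hc.le
        have := Fin.lt_def.1 huc
        exact Fin.ext (by omega)
      exact absurd (hcv ▸ hc) ((mem_free.1 hvf).2 a).2
  · intro h h0u
    have hua := mem_absorbed_of_rel_zero (v := v) hu h0u
    by_cases hvf : v ∈ free (IsArc v r)
    · exact rel_zero_of_mem_absorbed (h (absorbed_subset r hua) hvf hua)
    · exfalso
      rw [mem_free] at hvf
      push Not at hvf
      obtain ⟨b, hb⟩ := hvf hv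
      have hb := hb fun h' => absurd h'.le (not_le.2 h'.lt)
      have hbu : b ≠ u := fun h' => ((mem_free.1 (absorbed_subset r hua)).2 v).1 (h' ▸ hb)
      have hblt : b < u := by
        have h1 := Fin.lt_def.1 hb.lt
        refine Fin.lt_def.2 ?_
        have : (b : ℕ) ≠ u := fun h' => hbu (Fin.ext h')
        omega
      have h0b := hr 0 b u v (Fin.pos_of_ne_zero hb.ne_zero) hblt huv' h0u hb.rel
      exact hb.ne_zero ((isBlockMin_zero r).eq hb.min h0b).symm

/-- The admissible partitions with given arcs form a product of chains with two elements and at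
most one chain with three elements. Its ranks start at the number of arcs and end at `n` minus the
number of arcs. -/
theorem hasSymmetricPaths_admissible (huv : (u : ℕ) + 1 = v) (hu : u ≠ 0) :
    HasSymmetricPaths {p : NC (n + 1) | Admissible u v p.1} (IsAdmissibleMerge u v)
      (fun p => rank p.1) n := by
  have hne : u ≠ v := fun h => by rw [h] at huv; omega
  choose ι c lo inj rng full edge using
    fun A : Fin (n + 1) → Fin (n + 1) → Prop => hasSymmetricPaths_subsets (free A) hne
  have hmem : ∀ {p : NC (n + 1)}, Admissible u v p.1 → absorbed v p.1 ∈
      {S | S ⊆ free (IsArc v p.1) ∧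
        (u ∈ free (IsArc v p.1) → v ∈ free (IsArc v p.1) → u ∈ S → v ∈ S)} := fun hp =>
    ⟨absorbed_subset _, (imp_iff huv hu hp.noncrossing).1 hp.imp⟩
  refine ⟨Σ A, ι A, fun p => ⟨IsArc v p.1, c _ (absorbed v p.1)⟩,
    fun i => (openers i.1).card + lo i.1 i.2, ?_, ?_, ?_, ?_⟩
  · intro p hp q hq hc hρ
    obtain ⟨hA, hc⟩ := Sigma.mk.inj hc
    have hmp := hmem hp
    have hmq := hmem hq
    dsimp only at hρ
    rw [rank_eq (v := v), rank_eq (v := v) q.1] at hρ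
    rw [← hA] at hc hmq hρ
    have hS := inj _ _ hmp _ hmq (eq_of_heq hc) (by omega)
    exact Subtype.ext (eq_of_isArc_eq hp.noncrossing hq.noncrossing hp.tail hq.tail hA hS)
  · intro p hp
    have h1 := rng _ _ (hmem hp)
    have h2 := rank_eq (v := v) p.1
    have h3 := card_free (v := v) p.1
    dsimp only
    omega
  · intro p hp t h1 h2
    have h3 := card_free (v := v) p.1
    dsimp only at h1 h2
    obtain ⟨S, hS, hcS, hρ⟩ := full _ _ (hmem hp) (t - (openers (IsArc v p.1)).card)
      (by omega) (by omega)
    obtain ⟨r, hr, ht, hA, hrS⟩ := exists_absorbed_eq hp.noncrossing hp.tail S hS.1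
    refine ⟨⟨r, hr⟩, ⟨hr, ht, hA ▸ hp.not_isArc, ?_⟩, ?_, ?_⟩
    · rw [imp_iff huv hu hr, hA, hrS]
      exact hS.2
    · dsimp only
      rw [hA, hrS, hcS]
    · dsimp only
      rw [rank_eq (v := v), hA, hrS, hρ]
      omega
  · intro p hp q hq hc hρ
    obtain ⟨hA, hc⟩ := Sigma.mk.inj hc
    have hmp := hmem hp
    have hmq := hmem hq
    dsimp only at hρ
    rw [rank_eq (v := v), rank_eq (v := v) p.1] at hρ
    rw [← hA] at hc hmq hρ
    obtain ⟨x, hx, hqS⟩ := edge _ _ hmp _ hmq (eq_of_heq hc) (by omega)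
    have hxf : x ∈ free (IsArc v p.1) := hmq.1 (hqS ▸ Finset.mem_insert_self _ _)
    have hxm : IsBlockMin p.1 x := by
      by_contra h
      exact hx (mem_absorbed.2 ⟨hxf, h⟩)
    obtain ⟨r, hr, ht, hAr, hm⟩ := exists_add hp.noncrossing hp.tail hxf hxm
    have hrq : r = q.1 := eq_of_isArc_eq hr hq.noncrossing ht hq.tail (hAr.trans hA)
      ((hm.absorbed_eq hAr hxf).2.trans hqS.symm)
    subst hrq
    refine ⟨x, hm, ?_⟩
    rintro ⟨rfl, h⟩
    -- absorbing `v` into the block of `0` when this contains `u` would start at an excluded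
    -- partition
    have h0x : q.1 0 x := rel_zero_of_mem_absorbed (hqS ▸ Finset.mem_insert_self _ _)
    have hua := mem_absorbed_of_rel_zero (v := x) hu (q.1.trans h0x (q.1.symm h))
    rw [hqS, Finset.mem_insert] at hua
    have hua' := hua.resolve_left hne
    exact hx (hmp.2 (absorbed_subset _ hua') hxf hua')

theorem isMerge_cut_singleton {r : Setoid (Fin (n + 1))} {x : Fin (n + 1)}
    (hx : ¬ IsBlockMin r x) : IsMerge (cut r {x}) r x := by
  refine ⟨fun _ _ h => h.1, fun y hy => ?_, hx, fun y hyx hy => ?_⟩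
  · exact (Set.mem_singleton_iff.1 (hy.2.1 rfl)).ge
  · obtain ⟨z, hz, hzm, hzy⟩ := exists_blockMin r y
    have hzx : z ≠ x := fun h => hx (h ▸ hzm)
    have := hy z ⟨r.symm hz, by simp [hyx, hzx]⟩
    exact le_antisymm this hzy ▸ hzm

/-- From an admissible partition other than the bottom one can step down: split off the largest
point that is not a block minimum, or `u` if this point is `v` and lies in the block of `u`. -/
theorem Admissible.exists_isAdmissibleMerge_left (huv : (u : ℕ) + 1 = v) (hu : u ≠ 0)
    {q : NC (n + 1)} (hq : Admissible u v q.1) (h : ∃ x, ¬ IsBlockMin q.1 x) :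
    ∃ p : NC (n + 1), Admissible u v p.1 ∧ IsAdmissibleMerge u v p q := by
  have huv' : u < v := Fin.lt_def.2 (by omega)
  obtain ⟨x, hx, hmax⟩ := wellFounded_gt.has_min {x | ¬ IsBlockMin q.1 x} h
  have hmax' : ∀ y, ¬ IsBlockMin q.1 y → y ≤ x := fun y hy => not_lt.1 (hmax y hy)
  have hnc : ∀ z, IsNoncrossing (cut q.1 {z}) := fun z =>
    hq.noncrossing.cut Set.ordConnected_singleton
  by_cases hxv : x = v ∧ q.1 u v
  · -- splitting off `v` from the block of `u` is not allowed, splitting off `u` is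
    obtain ⟨rfl, hqu⟩ := hxv
    have hum : ¬ IsBlockMin q.1 u := fun h' => hq.not_isArc ((isArc_succ_iff huv hu).2 ⟨h', hqu⟩)
    have hm := isMerge_cut_singleton hum
    refine ⟨⟨_, hnc u⟩, ⟨hnc u, fun w y h1 h2 h3 => ?_, fun h1 => ?_, fun h1 => ?_⟩,
      u, hm, fun h1 => huv'.ne h1.1⟩
    · exact absurd (hmax' y fun h4 => h3 (h4.anti hm.le)) (not_le.2 h1)
    · exact huv'.ne' (h1.rel.2.1 rfl)
    · exact absurd (h1.2.2 rfl) (Ne.symm hu)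
  · have hm := isMerge_cut_singleton hx
    have hx0 : x ≠ 0 := fun h' => hx (h' ▸ isBlockMin_zero _)
    refine ⟨⟨_, hnc x⟩, ⟨hnc x, fun w y h1 h2 h3 => ?_, fun h1 => ?_, fun h1 => ?_⟩, x, hm, hxv⟩
    · have hy : ¬ IsBlockMin q.1 y := fun h4 => h3 (h4.anti hm.le)
      have hyx : y ≠ x := fun h' => h3 (h' ▸ hm.min)
      have hwx : w ≠ x := fun h' => by
        have := Fin.le_def.1 (hmax' y hy)
        rw [h'] at h2; omega
      exact ⟨hq.tail w y h1 h2 hy, by simp [hyx, hwx]⟩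
    · by_cases hux : u = x
      · exact huv'.ne' (hux ▸ h1.rel.2.1 hux)
      · exact hq.not_isArc ((isArc_succ_iff huv hu).2 ⟨hm.min_of_ne u hux h1.min, h1.rel.1⟩)
    · have h2 := hq.imp h1.1
      refine ⟨h2, ?_⟩
      have hvx : v ≠ x := fun h' => hxv ⟨h'.symm, q.1.trans (q.1.symm h1.1) h2⟩
      simp [hvx, Ne.symm hx0]

/-- From an admissible partition other than the top one can step up. If a point beyond `v` is a
block minimum, join it to its predecessor. Otherwise, join `v` to `0` if `v` is a block minimum, and
if it is not, join any nonzero block minimum to its predecessor. -/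
theorem Admissible.exists_isAdmissibleMerge_right (huv : (u : ℕ) + 1 = v) (hu : u ≠ 0)
    {p : NC (n + 1)} (hp : Admissible u v p.1) (h : ∃ x, x ≠ 0 ∧ IsBlockMin p.1 x) :
    ∃ q : NC (n + 1), Admissible u v q.1 ∧ IsAdmissibleMerge u v p q := by
  have huv' : u < v := Fin.lt_def.2 (by omega)
  have hv0 : 0 < v := (Fin.zero_le u).trans_lt huv'
  -- the tail condition survives a join
  have tail : ∀ {q : Setoid (Fin (n + 1))} {x : Fin (n + 1)}, IsMerge p.1 q x →
      (∀ w : Fin (n + 1), v < x → (w : ℕ) + 1 = x → q w x) → HasLinearTail v q := by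
    intro q x hm hx w y h1 h2 h3
    by_cases hy : y = x
    · subst hy; exact hx w h1 h2
    · exact hm.le (hp.tail w y h1 h2 fun h4 => h3 (hm.min_of_ne y hy h4))
  by_cases hA : ∃ x, v < x ∧ IsBlockMin p.1 x
  · obtain ⟨x, hvx, hxm⟩ := hA
    obtain ⟨w, hw⟩ := exists_prev x hvx
    have hm := isMerge_join hxm (Fin.lt_def.2 (by omega) : w < x)
    have hnc := hp.noncrossing.join_succ hw
    have hno : ∀ z, z ≤ v → ¬ p.1 z x := fun z hz h1 =>
      absurd (hxm z (p.1.symm h1)) (not_le.2 (hz.trans_lt hvx))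
    refine ⟨⟨_, hnc⟩, ⟨hnc, tail hm fun w' _ h1 => ?_, fun h1 => ?_, fun h1 => ?_⟩, x, hm,
      fun h1 => hvx.ne' h1.1⟩
    · have : w' = w := Fin.ext (by omega)
      exact this ▸ join_rel_self _ _ _
    · exact hp.not_isArc ((isArc_succ_iff huv hu).2 ⟨h1.min.anti hm.le,
        hm.rel_of_not h1.rel (hno u huv'.le) (hno v le_rfl)⟩)
    · exact hm.le (hp.imp (hm.rel_of_not h1 (hno 0 hv0.le) (hno u huv'.le)))
  push Not at hA
  -- from here on `v` and all later points are in one block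
  have htl : ∀ N : ℕ, ∀ y : Fin (n + 1), (y : ℕ) = N → v ≤ y → p.1 v y := by
    intro N
    induction N with
    | zero =>
      intro y hy hvy
      have h1 := Fin.le_def.1 hvy
      have h2 := Fin.lt_def.1 hv0
      simp at h2
      omega
    | succ N ih =>
      intro y hy hvy
      rcases hvy.eq_or_lt with rfl | hlt
      · exact p.1.refl v
      · have h1 := Fin.lt_def.1 hlt
        exact p.1.trans (ih ⟨N, by omega⟩ rfl (Fin.le_def.2 (by simp; omega)))
          (hp.tail _ y hlt hy.symm (hA y hlt))
  by_cases hvm : IsBlockMin p.1 v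
  · have hm := isMerge_join hvm hv0
    have hnc : IsNoncrossing (join p.1 0 v) := by
      refine hp.noncrossing.join fun c d hcd _ hcv _ => ⟨fun h1 => ?_, fun h1 => ?_⟩
      · exact absurd h1.1 (Fin.not_lt_zero c)
      · exact absurd (p.1.trans hcd (p.1.symm (htl d d rfl h1.2.le))) hcv
    have hjuv : ¬ join p.1 0 v u v := by
      have h1 : ¬ p.1 u v := fun h2 => absurd (hvm u (p.1.symm h2)) (not_le.2 huv')
      have h2 : ¬ p.1 u 0 := fun h3 =>
        absurd (hvm 0 (p.1.symm (hp.imp (p.1.symm h3)))) (not_le.2 hv0)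
      rintro (h3 | ⟨h3 | h3, -⟩)
      · exact h1 h3
      · exact h2 h3
      · exact h1 h3
    exact ⟨⟨_, hnc⟩, ⟨hnc, tail hm fun w h1 => absurd h1 (lt_irrefl v), fun h1 => hjuv h1.rel,
      fun _ => join_rel_self _ _ _⟩, v, hm, fun h1 => hjuv h1.2⟩
  · obtain ⟨x, hx0, hxm⟩ := h
    have hxv : x < v := by
      rcases lt_trichotomy x v with h1 | h1 | h1
      · exact h1
      · exact absurd (h1 ▸ hxm) hvm
      · exact absurd hxm (hA x h1)
    obtain ⟨w, hw⟩ := exists_prev x (Fin.pos_of_ne_zero hx0)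
    have hm := isMerge_join hxm (Fin.lt_def.2 (by omega) : w < x)
    have hnc := hp.noncrossing.join_succ hw
    obtain ⟨z, hzv, hzm, hle⟩ := exists_blockMin p.1 v
    have hzlt : z < v := lt_of_le_of_ne hle fun h' => hvm (h' ▸ hzm)
    have hzu : z ≠ u := fun h' => hp.not_isArc ((isArc_succ_iff huv hu).2 ⟨h' ▸ hzm, h' ▸ hzv⟩)
    have hzu' : z < u := by
      have h1 := Fin.lt_def.1 hzlt
      have h2 : (z : ℕ) ≠ u := fun h' => hzu (Fin.ext h')
      exact Fin.lt_def.2 (by omega)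
    refine ⟨⟨_, hnc⟩, ⟨hnc, tail hm fun w h1 => absurd h1 hxv.not_gt, fun h1 => ?_, fun h1 => ?_⟩,
      x, hm, fun h1 => hxv.ne h1.1⟩
    · exact absurd (h1.min z ((join p.1 w x).trans h1.rel ((join p.1 w x).symm (hm.le hzv))))
        (not_le.2 hzu')
    · rcases eq_or_ne z 0 with h0 | h0
      · exact h0 ▸ hm.le hzv
      · exact (join p.1 w x).trans
          (hnc 0 z u v (Fin.pos_of_ne_zero h0) hzu' huv' h1 (hm.le hzv)) (hm.le hzv)

end

/-! ### Labels along maximal chains -/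

section
variable {n : ℕ} {u v : Fin (n + 1)}

/-- A sequence that is bounded by a permutation of `1, …, n` is a parking function. -/
theorem isParkingFunction_of_le {a : Fin n → ℕ} {x : Fin n → Fin (n + 1)}
    (hx : Function.Injective x) (h1 : ∀ i, 1 ≤ a i) (hax : ∀ i, a i ≤ x i) :
    IsParkingFunction a := by
  refine ⟨h1, Tuple.sort a, Tuple.monotone_sort a, fun i => ?_⟩
  by_contra hlt
  have hmaps : ∀ j ∈ Finset.Ici i, ((x (Tuple.sort a j) : Fin (n + 1)) : ℕ) ∈
      Finset.Icc ((i : ℕ) + 2) n := by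
    intro j hj
    have h2 : a (Tuple.sort a i) ≤ a (Tuple.sort a j) :=
      Tuple.monotone_sort a (Finset.mem_Ici.1 hj)
    have h3 := hax (Tuple.sort a j)
    have h4 := (x (Tuple.sort a j)).isLt
    rw [Finset.mem_Icc]
    omega
  have h5 := Finset.card_le_card_of_injOn _ hmaps
    (fun j _ j' _ h => (Tuple.sort a).injective (hx (Fin.ext h)))
  rw [Fin.card_Ici, Nat.card_Icc] at h5
  have := i.isLt
  omega

theorem isBlockMin_bot (x : Fin (n + 1)) : IsBlockMin (⊥ : Setoid (Fin (n + 1))) x :=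
  fun _ h => le_of_eq h

theorem isBlockMin_of_isBot {p : NC (n + 1)} (h : IsBot p) (x : Fin (n + 1)) :
    IsBlockMin p.1 x := by
  have hb : IsNoncrossing (⊥ : Setoid (Fin (n + 1))) := fun a b c d h1 h2 _ hac _ =>
    absurd hac (h1.trans h2).ne
  exact (isBlockMin_bot x).anti (h ⟨⊥, hb⟩)

theorem rel_of_isTop {p : NC (n + 1)} (h : IsTop p) (x y : Fin (n + 1)) : p.1 x y := by
  have hb : IsNoncrossing (⊤ : Setoid (Fin (n + 1))) := fun a b c d _ _ _ _ _ => trivial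
  exact h ⟨⊤, hb⟩ trivial

section chain
variable {c : Fin (n + 1) → NC (n + 1)} {x : Fin n → Fin (n + 1)}

theorem monotone_of_isMerge (h : ∀ i : Fin n, IsMerge (c i.castSucc).1 (c i.succ).1 (x i)) :
    Monotone c := Fin.monotone_iff_le_succ.2 fun i => (h i).le

theorem injective_of_isMerge (h : ∀ i : Fin n, IsMerge (c i.castSucc).1 (c i.succ).1 (x i)) :
    Function.Injective x := by
  have key : ∀ i j, i < j → x i ≠ x j := fun i j hij he => by
    have hle : c i.succ ≤ c j.castSucc := monotone_of_isMerge h (Fin.succ_le_castSucc_iff.2 hij)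
    exact (h i).not_min ((he ▸ (h j).min).anti hle)
  intro i j hij
  rcases lt_trichotomy i j with h1 | h1 | h1
  · exact absurd hij (key i j h1)
  · exact h1
  · exact absurd hij.symm (key j i h1)

/-- A point that is not the minimum of its block has been joined to a smaller point at some step
of the chain. -/
theorem exists_of_not_isBlockMin (h : ∀ i : Fin n, IsMerge (c i.castSucc).1 (c i.succ).1 (x i))
    (h0 : ∀ z, IsBlockMin (c 0).1 z) (t : Fin (n + 1)) {z : Fin (n + 1)}
    (hz : ¬ IsBlockMin (c t).1 z) : ∃ i, x i = z := by
  induction t using Fin.induction with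
  | zero => exact absurd (h0 z) hz
  | succ i ih =>
    by_cases hi : IsBlockMin (c i.castSucc).1 z
    · by_contra hne
      exact hz ((h i).min_of_ne z (fun h' => hne ⟨i, h'.symm⟩) hi)
    · exact ih hi

end chain

theorem admissible_of_isPFChain (huv : (u : ℕ) + 1 = v) (hu : u ≠ 0)
    {c : Fin (n + 1) → NC (n + 1)} (hc : IsPFChain n v c) :
    (∀ t, Admissible u v (c t).1) ∧
      ∀ i : Fin n, ∃ x, IsMerge (c i.castSucc).1 (c i.succ).1 x := by
  obtain ⟨⟨hbot, htop, hcov⟩, a, ⟨-, hk, hj⟩, hlab⟩ := hc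
  choose x y hm hy hay using fun i => exists_isMerge_of_isEdgeLabel (hcov i) (hlab i)
  have huv' : u < v := Fin.lt_def.2 (by omega)
  have hinj := injective_of_isMerge hm
  -- the only merge with label `j` beyond `v` is the one at which `j` is joined to a smaller point
  have htail : ∀ N : ℕ, ∀ i, n - (x i : ℕ) = N → v < x i → (y i : ℕ) + 1 = x i := by
    intro N
    induction N using Nat.strong_induction_on with
    | _ N ih =>
      intro i hi hv
      have hvi := Fin.lt_def.1 hv
      have hxn := (x i).isLt
      obtain ⟨i', hi'⟩ := hj (x i) (by omega) (by omega)
      rw [hay] at hi'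
      have hyx := Fin.lt_def.1 (hy i').1
      rcases Nat.lt_or_ge (x i) (x i') with h1 | h1
      · have hxn' := (x i').isLt
        have := ih (n - (x i' : ℕ)) (by omega) i' rfl (Fin.lt_def.2 (by omega))
        omega
      · have : x i' = x i := Fin.ext (by omega)
        have := hinj this
        subst this
        exact hi'
  -- this merge would have the label `k`
  have hnl : ∀ i, x i = v → ¬ (c i.succ).1 u v := by
    intro i hi h
    have h1 := (hy i).2.2 u (hi ▸ h) (hi ▸ huv')
    have h2 := Fin.lt_def.1 (hy i).1
    have h3 := Fin.le_def.1 h1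
    rw [hi] at h2
    exact hk ⟨i, by rw [hay]; omega⟩
  have hT : ∀ t, HasLinearTail v (c t).1 := by
    intro t
    induction t using Fin.induction with
    | zero => exact fun w z _ _ h => absurd (isBlockMin_of_isBot hbot z) h
    | succ i ih =>
      intro w z h1 h2 h3
      by_cases hz : z = x i
      · subst hz
        have h4 := htail _ i rfl h1
        have : w = y i := Fin.ext (by omega)
        exact this ▸ (hy i).2.1
      · exact (hm i).le (ih w z h1 h2 fun h => h3 ((hm i).min_of_ne z hz h))
  have hA : ∀ t, ¬ IsArc v (c t).1 u v := by
    intro t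
    induction t using Fin.induction with
    | zero => exact fun h => h.not_isBlockMin (isBlockMin_of_isBot hbot v)
    | succ i ih =>
      intro h
      by_cases hpuv : (c i.castSucc).1 u v
      · exact ih ((isArc_succ_iff huv hu).2 ⟨h.min.anti (hm i).le, hpuv⟩)
      · obtain ⟨z, hz, hzm, hle⟩ := exists_blockMin (c i.castSucc).1 v
        by_cases hzv : z = v
        · refine hnl i ?_ h.rel
          by_contra hne
          exact h.not_isBlockMin ((hm i).min_of_ne v (Ne.symm hne) (hzv ▸ hzm))
        · have h1 := h.min z ((c i.succ).1.trans h.rel ((c i.succ).1.symm ((hm i).le hz)))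
          have h2 : z ≠ u := fun h' => hpuv (h' ▸ hz)
          have h3 := Fin.lt_def.1 (lt_of_le_of_ne hle hzv)
          have h4 := Fin.le_def.1 h1
          exact h2 (Fin.ext (by omega))
  -- downward from the top: otherwise `v` would have to be joined to the block of `u`
  have hI : ∀ t, (c t).1 0 u → (c t).1 0 v := by
    intro t
    induction t using Fin.reverseInduction with
    | last => exact fun _ => rel_of_isTop htop 0 v
    | cast i ih =>
      intro h0u
      by_contra h0v
      have h1 := (hm i).le h0u
      have h2 := ih h1
      have h3 : (c i.succ).1 u v := (c i.succ).1.trans ((c i.succ).1.symm h1) h2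
      refine hnl i ?_ h3
      obtain ⟨z, hz, hzm, hle⟩ := exists_blockMin (c i.castSucc).1 v
      have hzv : z = v := by
        by_contra hzv
        have hz0 : z ≠ 0 := fun h => h0v (h ▸ hz)
        have hzu : z ≠ u := fun h => h0v ((c i.castSucc).1.trans h0u (h ▸ hz))
        have hlt : z < u := by
          have h4 := Fin.lt_def.1 (lt_of_le_of_ne hle hzv)
          have h5 : (z : ℕ) ≠ u := fun h => hzu (Fin.ext h)
          exact Fin.lt_def.2 (by omega)
        have := (c i.castSucc).2 0 z u v (Fin.pos_of_ne_zero hz0) hlt huv' h0u hz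
        exact h0v ((c i.castSucc).1.trans this hz)
      by_contra hne
      have hvm := (hm i).min_of_ne v (Ne.symm hne) (hzv ▸ hzm)
      have := hvm 0 ((c i.succ).1.symm h2)
      exact absurd this (not_le.2 ((Fin.zero_le u).trans_lt huv'))
  exact ⟨fun t => ⟨(c t).2, hT t, hA t, hI t⟩, fun i => ⟨x i, hm i⟩⟩

/-! ### Maximal chains through admissible partitions -/

theorem rank_eq_zero_iff {r : Setoid (Fin (n + 1))} : rank r = 0 ↔ ∀ x, IsBlockMin r x := by
  classical
  simp [rank, Finset.filter_eq_empty_iff]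

theorem rank_le (r : Setoid (Fin (n + 1))) : rank r ≤ n := by
  have h1 := rank_eq (v := 0) r
  have h2 := card_free (v := 0) r
  have h3 := Finset.card_le_card (absorbed_subset (v := 0) r)
  omega

theorem eq_zero_of_rank_eq {r : Setoid (Fin (n + 1))} (h : rank r = n) {x : Fin (n + 1)}
    (hx : IsBlockMin r x) : x = 0 := by
  classical
  by_contra h0
  have hsub : (Finset.univ.filter fun x => ¬ IsBlockMin r x) ⊆ (Finset.univ.erase 0).erase x := by
    intro z hz
    have hz' := (Finset.mem_filter.1 hz).2
    exact Finset.mem_erase.2 ⟨fun h => hz' (h ▸ hx),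
      Finset.mem_erase.2 ⟨fun h => hz' (h ▸ isBlockMin_zero r), Finset.mem_univ _⟩⟩
  have h1 := Finset.card_le_card hsub
  rw [Finset.card_erase_of_mem (by simp [h0]), Finset.card_erase_of_mem (Finset.mem_univ _),
    Finset.card_univ, Fintype.card_fin] at h1
  have h2 : rank r ≤ n + 1 - 1 - 1 := h1
  have h3 : 0 < n := by
    have := x.isLt
    have := Fin.lt_def.1 (Fin.pos_of_ne_zero h0)
    omega
  omega

theorem isBot_of_rank_eq_zero {p : NC (n + 1)} (h : rank p.1 = 0) : IsBot p := by
  intro q a b hab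
  have hm := rank_eq_zero_iff.1 h
  have : a = b := (hm a).eq (hm b) hab
  exact this ▸ q.1.refl a

theorem isTop_of_rank_eq {p : NC (n + 1)} (h : rank p.1 = n) : IsTop p := by
  have key : ∀ x, p.1 0 x := fun x => by
    obtain ⟨y, hy, hm, -⟩ := exists_blockMin p.1 x
    exact eq_zero_of_rank_eq h hm ▸ hy
  exact fun q a b _ => p.1.trans (p.1.symm (key a)) (key b)

/-- A sequence of admissible merges from bottom to top is a maximal chain whose labels form an
element of `PF_{n,k}`. -/
theorem isPFChain_of_isAdmissibleMerge (huv : (u : ℕ) + 1 = v) {c : ℕ → NC (n + 1)}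
    (h0 : rank (c 0).1 = 0) (hn : rank (c n).1 = n) (had : ∀ i ≤ n, Admissible u v (c i).1)
    (hm : ∀ i < n, IsAdmissibleMerge u v (c i) (c (i + 1))) :
    IsPFChain n v fun i : Fin (n + 1) => c i := by
  choose x hx hne using fun i : Fin n => hm i i.isLt
  choose y hy using fun i : Fin n => exists_isPred (hx i).not_min
  have hinj : Function.Injective x :=
    injective_of_isMerge (c := fun i : Fin (n + 1) => c i) hx
  refine ⟨⟨isBot_of_rank_eq_zero h0, isTop_of_rank_eq hn, fun i => (hx i).covBy⟩,
    fun i => y i + 1, ⟨?_, ?_, ?_⟩, fun i => (hx i).isEdgeLabel (hy i)⟩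
  · exact isParkingFunction_of_le hinj (fun i => Nat.le_add_left 1 _)
      fun i => Fin.lt_def.1 (hy i).1
  · rintro ⟨i, hi⟩
    have hi' : y i = u := Fin.ext (by dsimp only at hi; omega)
    have hyx := Fin.lt_def.1 (hy i).1
    by_cases hxv : x i = v
    · refine hne i ⟨hxv, ?_⟩
      rw [← hi']
      exact hxv ▸ (hy i).2.1
    · have hlt : v < x i := lt_of_le_of_ne (Fin.le_def.2 (by omega)) (Ne.symm hxv)
      obtain ⟨w, hw⟩ := exists_prev (x i) hlt
      have h1 := (had (i + 1) (by omega)).tail w (x i) hlt hw (hx i).not_min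
      have h2 := Fin.le_def.1 ((hy i).2.2 w h1 (Fin.lt_def.2 (by omega)))
      have h3 := Fin.lt_def.1 hlt
      omega
  · intro j hj1 hj2
    have hjn : j < n + 1 := by omega
    obtain ⟨i, hi⟩ := exists_of_not_isBlockMin (c := fun i : Fin (n + 1) => c i) hx
      (rank_eq_zero_iff.1 h0) (Fin.last n) (z := ⟨j, hjn⟩) fun h => by
        have := congrArg Fin.val (eq_zero_of_rank_eq hn h)
        simp at this
        omega
    have hij : ((x i : Fin (n + 1)) : ℕ) = j := congrArg Fin.val hi
    have hlt : v < x i := Fin.lt_def.2 (by omega)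
    obtain ⟨w, hw⟩ := exists_prev (x i) hlt
    have h1 := (had (i + 1) (by omega)).tail w (x i) hlt hw (hx i).not_min
    have h2 := Fin.le_def.1 ((hy i).2.2 w h1 (Fin.lt_def.2 (by omega)))
    have h3 := Fin.lt_def.1 (hy i).1
    exact ⟨i, by dsimp only; omega⟩

theorem IsAdmissibleMerge.rank_eq {p q : NC (n + 1)} (h : IsAdmissibleMerge u v p q) :
    rank q.1 = rank p.1 + 1 := by
  obtain ⟨x, hx, -⟩ := h
  exact hx.rank_eq

theorem exists_path_to (huv : (u : ℕ) + 1 = v) (hu : u ≠ 0) (r : ℕ) (p : NC (n + 1))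
    (hp : Admissible u v p.1) (hr : rank p.1 = r) :
    ∃ c : ℕ → NC (n + 1), c r = p ∧ rank (c 0).1 = 0 ∧ (∀ i ≤ r, Admissible u v (c i).1) ∧
      ∀ i < r, IsAdmissibleMerge u v (c i) (c (i + 1)) := by
  induction r generalizing p with
  | zero =>
    exact ⟨fun _ => p, rfl, hr, fun _ _ => hp, fun i h => absurd h (Nat.not_lt_zero i)⟩
  | succ r ih =>
    obtain ⟨q, hq, hqp⟩ := hp.exists_isAdmissibleMerge_left huv hu (by
      by_contra h
      push Not at h
      have := rank_eq_zero_iff.2 h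
      omega)
    obtain ⟨c, hc, h0, had, hm⟩ := ih q hq (by have := hqp.rank_eq; omega)
    refine ⟨Function.update c (r + 1) p, by simp, ?_, fun i hi => ?_, fun i hi => ?_⟩
    · rw [Function.update_of_ne (by omega)]
      exact h0
    · rcases Nat.lt_or_ge i (r + 1) with h | h
      · rw [Function.update_of_ne (by omega)]
        exact had i (by omega)
      · have : i = r + 1 := by omega
        subst this
        simpa using hp
    · rw [Function.update_of_ne (by omega)]
      rcases Nat.lt_or_ge i r with h | h
      · rw [Function.update_of_ne (by omega)]
        exact hm i h
      · have : i = r := by omega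
        subst this
        simpa [hc] using hqp

theorem exists_path_from (huv : (u : ℕ) + 1 = v) (hu : u ≠ 0) (s : ℕ) (p : NC (n + 1))
    (hp : Admissible u v p.1) (hs : rank p.1 + s = n) :
    ∃ c : ℕ → NC (n + 1), c (rank p.1) = p ∧ rank (c n).1 = n ∧
      (∀ i, rank p.1 ≤ i → Admissible u v (c i).1) ∧
      ∀ i, rank p.1 ≤ i → i < n → IsAdmissibleMerge u v (c i) (c (i + 1)) := by
  induction s generalizing p with
  | zero => exact ⟨fun _ => p, rfl, by omega, fun _ _ => hp, fun i h1 h2 => by omega⟩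
  | succ s ih =>
    obtain ⟨q, hq, hpq⟩ := hp.exists_isAdmissibleMerge_right huv hu (by
      by_contra h
      push Not at h
      have hsub : (Finset.univ.erase (0 : Fin (n + 1))).card ≤ rank p.1 := by
        classical
        exact Finset.card_le_card fun z hz =>
          Finset.mem_filter.2 ⟨Finset.mem_univ _, h z (Finset.mem_erase.1 hz).1⟩
      rw [Finset.card_erase_of_mem (Finset.mem_univ _), Finset.card_univ, Fintype.card_fin] at hsub
      omega)
    have hr := hpq.rank_eq
    obtain ⟨c, hc, hn, had, hm⟩ := ih q hq (by omega)
    refine ⟨Function.update c (rank p.1) p, by simp, ?_, fun i hi => ?_, fun i hi hin => ?_⟩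
    · rw [Function.update_of_ne (by omega)]
      exact hn
    · rcases hi.eq_or_lt with h | h
      · rw [← h]
        simpa using hp
      · rw [Function.update_of_ne (by omega)]
        exact had i (by omega)
    · rw [Function.update_of_ne (by omega : i + 1 ≠ rank p.1)]
      rcases hi.eq_or_lt with h | h
      · rw [← h, ← hr, hc]
        simpa using hpq
      · rw [Function.update_of_ne (by omega)]
        exact hm i (by omega) hin

theorem isPFEdge_of_isAdmissibleMerge (huv : (u : ℕ) + 1 = v) (hu : u ≠ 0) {p q : NC (n + 1)}
    (hp : Admissible u v p.1) (hq : Admissible u v q.1) (h : IsAdmissibleMerge u v p q) :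
    IsPFEdge n v p q := by
  have hr := h.rank_eq
  have hqn := rank_le q.1
  obtain ⟨d, hd, hd0, hdad, hdm⟩ := exists_path_to huv hu _ p hp rfl
  obtain ⟨e, he, hen, head, hem⟩ := exists_path_from huv hu (n - rank q.1) q hq (by omega)
  let c : ℕ → NC (n + 1) := fun i => if i ≤ rank p.1 then d i else e i
  have hcd : ∀ i, i ≤ rank p.1 → c i = d i := fun i hi => if_pos hi
  have hce : ∀ i, rank p.1 < i → c i = e i := fun i hi => if_neg (not_le.2 hi)
  refine ⟨fun i => c i, isPFChain_of_isAdmissibleMerge huv ?_ ?_ (fun i hi => ?_)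
    (fun i hi => ?_), ⟨rank p.1, by omega⟩, ?_, ?_⟩
  · rw [hcd 0 (Nat.zero_le _)]; exact hd0
  · rw [hce n (by omega)]; exact hen
  · rcases Nat.lt_or_ge (rank p.1) i with h1 | h1
    · rw [hce i h1]; exact head i (by omega)
    · rw [hcd i h1]; exact hdad i h1
  · rcases lt_trichotomy i (rank p.1) with h1 | h1 | h1
    · rw [hcd i h1.le, hcd (i + 1) h1]; exact hdm i h1
    · rw [hcd i h1.le, hce (i + 1) (by omega), h1, hd, ← hr, he]; exact h
    · rw [hce i h1, hce (i + 1) (by omega)]; exact hem i (by omega) hi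
  · exact (hcd _ le_rfl).trans hd
  · exact (hce (rank p.1 + 1) (Nat.lt_succ_self _)).trans (hr ▸ he)

theorem mem_range_isPFChain_iff (huv : (u : ℕ) + 1 = v) (hu : u ≠ 0) {p : NC (n + 1)} :
    (∃ c, IsPFChain n v c ∧ p ∈ Set.range c) ↔ Admissible u v p.1 := by
  constructor
  · rintro ⟨c, hc, t, rfl⟩
    exact (admissible_of_isPFChain huv hu hc).1 t
  · intro hp
    by_cases h0 : rank p.1 = 0
    · obtain ⟨q, hq, hpq⟩ := hp.exists_isAdmissibleMerge_right huv hu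
        ⟨u, hu, rank_eq_zero_iff.1 h0 u⟩
      obtain ⟨c, hc, i, hi, -⟩ := isPFEdge_of_isAdmissibleMerge huv hu hp hq hpq
      exact ⟨c, hc, _, hi⟩
    · obtain ⟨q, hq, hqp⟩ := hp.exists_isAdmissibleMerge_left huv hu (by
        by_contra h
        push Not at h
        exact h0 (rank_eq_zero_iff.2 h))
      obtain ⟨c, hc, i, -, hi⟩ := isPFEdge_of_isAdmissibleMerge huv hu hq hp hqp
      exact ⟨c, hc, _, hi⟩

end

/-! ### From symmetric paths to a symmetric chain decomposition -/

section
variable {P : Type} [PartialOrder P] {ρ : P → ℕ} {N : ℕ}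

theorem height_eq_of_rank (hlt : ∀ x y, x < y → ρ x < ρ y)
    (hdown : ∀ x, ρ x ≠ 0 → ∃ y, y < x ∧ ρ x = ρ y + 1) (x : P) : Order.height x = ρ x := by
  have key : ∀ r x, ρ x = r → Order.height x = r := by
    intro r
    induction r using Nat.strong_induction_on with
    | _ r ih =>
      intro x hx
      refine le_antisymm ?_ ?_
      · refine Order.height_le_coe_iff.2 fun y hy => ?_
        have h1 := hlt y x hy
        rw [ih _ (hx ▸ h1) y rfl]
        exact_mod_cast hx ▸ h1
      · rcases Nat.eq_zero_or_pos r with h0 | h0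
        · simp [h0]
        · obtain ⟨y, hy, hρ⟩ := hdown x (by omega)
          have h1 := ih (ρ y) (by omega) y rfl
          have h2 := Order.height_add_one_le hy
          rw [h1] at h2
          have : r = ρ y + 1 := by omega
          rw [this]
          exact_mod_cast h2
  exact key _ x rfl

/-- In a poset of finite height with rank function `ρ`, a decomposition into symmetric paths of the
Hasse diagram is a symmetric chain decomposition. -/
theorem hasSymmetricChainDecomposition_of_paths (hlt : ∀ x y : P, x < y → ρ x < ρ y)
    (hcov : ∀ x y : P, x ⋖ y → ρ y = ρ x + 1)
    (hdown : ∀ x, ρ x ≠ 0 → ∃ y, y < x ∧ ρ x = ρ y + 1) (hle : ∀ x, ρ x ≤ N)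
    (htop : ∃ x, ρ x = N) (h : HasSymmetricPaths (Set.univ : Set P) (· ⋖ ·) ρ N) :
    HasSymmetricChainDecomposition P := by
  have hh := height_eq_of_rank hlt hdown
  have hdim : Order.krullDim P = (N : ℕ∞) := by
    obtain ⟨t, ht⟩ := htop
    have : Nonempty P := ⟨t⟩
    rw [Order.krullDim_eq_iSup_height_of_nonempty]
    refine congrArg (fun m : ℕ∞ => (m : WithBot ℕ∞)) ?_
    refine le_antisymm (iSup_le fun x => ?_) ?_
    · rw [hh]; exact_mod_cast hle x
    · rw [← ht, ← hh]; exact le_iSup (fun x : P => Order.height x) t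
  obtain ⟨ι, c, lo, inj, rng, full, edge⟩ := h
  refine ⟨fun x y hxy => by rw [hh, hh, hcov x y hxy]; push_cast; rfl,
    {C | ∃ x, C = {y | c y = c x}}, ⟨?_, fun x => ?_⟩, ?_⟩
  · rintro ⟨x, hx⟩
    have : x ∈ (∅ : Set P) := hx ▸ rfl
    exact this
  · refine ⟨{y | c y = c x}, ⟨⟨x, rfl⟩, rfl⟩, ?_⟩
    rintro C ⟨⟨z, rfl⟩, hz⟩
    have hz' : c x = c z := hz
    ext y
    simp [hz']
  · rintro C ⟨x, rfl⟩
    -- elements of one path are comparable, in the order of their ranks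
    have hcomp : ∀ d y z, c y = c x → c z = c x → ρ z = ρ y + d → y ≤ z := by
      intro d
      induction d with
      | zero =>
        intro y z hy hz hρ
        exact (inj y trivial z trivial (hy.trans hz.symm) hρ.symm).le
      | succ d ih =>
        intro y z hy hz hρ
        have h1 := rng y trivial
        have h2 := rng z trivial
        rw [hy] at h1
        rw [hz] at h2
        obtain ⟨w, -, hw, hρw⟩ := full x trivial (ρ y + d) (by omega) (by omega)
        exact (ih y w hy hw hρw).trans
          (edge w trivial z trivial (hw.trans hz.symm) (by omega)).le
    have hcomp' : ∀ y z, c y = c x → c z = c x → ρ y ≤ ρ z → y ≤ z := fun y z hy hz hyz =>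
      hcomp (ρ z - ρ y) y z hy hz (by omega)
    have hx := rng x trivial
    obtain ⟨a, -, ha, hρa⟩ := full x trivial (lo (c x)) le_rfl (by omega)
    obtain ⟨b, -, hb, hρb⟩ := full x trivial (N - lo (c x)) (by omega) (by omega)
    refine ⟨⟨fun y hy z hz _ => ?_, ?_⟩, a, b, ⟨ha, fun y hy => ?_⟩, ⟨hb, fun y hy => ?_⟩, ?_⟩
    · rcases le_total (ρ y) (ρ z) with h1 | h1
      · exact .inl (hcomp' y z hy hz h1)
      · exact .inr (hcomp' z y hz hy h1)
    · rintro ⟨y, hy⟩ ⟨z, hz⟩ hyz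
      have hy' : c y = c x := hy
      have hz' : c z = c x := hz
      have hlt' : ρ y < ρ z := hlt y z hyz.lt
      have h2 := rng y trivial
      have h3 := rng z trivial
      rw [hy'] at h2
      rw [hz'] at h3
      obtain ⟨w, -, hw, hρw⟩ := full x trivial (ρ y + 1) (by omega) (by omega)
      have hyw : y ⋖ w := edge y trivial w trivial (hy'.trans hw.symm) hρw
      rcases (hcomp' w z hw hz' (by omega)).eq_or_lt with h4 | h4
      · exact h4 ▸ hyw
      · exact absurd (show (⟨w, hw⟩ : {y | c y = c x}) < ⟨z, hz⟩ from h4)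
          (hyz.2 (show (⟨y, hy⟩ : {y | c y = c x}) < ⟨w, hw⟩ from hyw.lt))
    · have hy' : c y = c x := hy
      have h2 := rng y trivial
      rw [hy'] at h2
      exact hcomp' a y ha hy (by omega)
    · have hy' : c y = c x := hy
      have h2 := rng y trivial
      rw [hy'] at h2
      exact hcomp' y b hy hb (by omega)
    · rw [hh, hh, hdim, hρa, hρb]
      have : lo (c x) + (N - lo (c x)) = N := by omega
      exact_mod_cast congrArg (fun m : ℕ => ((m : ℕ∞) : WithBot ℕ∞)) this

end

end ParkingPoset

theorem mainTheorem7 (n k : ℕ) (hk : 1 < k) (hkn : k ≤ n) :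
    ParkingPoset.HasSymmetricChainDecomposition (ParkingPoset.PosetPF n k) := by
  open ParkingPoset in
  obtain ⟨v, rfl⟩ : ∃ v : Fin (n + 1), (v : ℕ) = k := ⟨⟨k, by omega⟩, rfl⟩
  obtain ⟨u, huv⟩ : ∃ u : Fin (n + 1), (u : ℕ) + 1 = v := ⟨⟨v - 1, by omega⟩, by simp; omega⟩
  have hu : u ≠ 0 := by
    rintro rfl
    simp at huv
    omega
  have hadm : ∀ x : PosetPF n v, Admissible u v x.1.1 := fun x =>
    (mem_range_isPFChain_iff huv hu).1 x.2
  have hmem : ∀ p : NC (n + 1), Admissible u v p.1 → ∃ x : PosetPF n v, x.1 = p := fun p hp =>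
    ⟨⟨p, (mem_range_isPFChain_iff huv hu).2 hp⟩, rfl⟩
  have hcov : ∀ x y : PosetPF n v, IsAdmissibleMerge u v x.1 y.1 → x ⋖ y := fun x y h =>
    (PosetPF.covBy_iff x y).2 (isPFEdge_of_isAdmissibleMerge huv hu (hadm x) (hadm y) h)
  refine hasSymmetricChainDecomposition_of_paths (ρ := fun x : PosetPF n v => rank x.1.1) (N := n)
    (fun x y hxy => ?_) (fun x y hxy => ?_) (fun x hx => ?_) (fun x => rank_le _) ?_ ?_
  · have hle : x.1 ≤ y.1 := le_of_reflTransGen hxy.le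
    exact rank_lt_rank (lt_of_le_of_ne hle fun h => hxy.ne (Subtype.ext (Subtype.ext h)))
  · obtain ⟨c, hc, i, hi, hi'⟩ := (PosetPF.covBy_iff x y).1 hxy
    obtain ⟨z, hz⟩ := (admissible_of_isPFChain huv hu hc).2 i
    rw [hi, hi'] at hz
    exact hz.rank_eq
  · obtain ⟨q, hq, hqx⟩ := (hadm x).exists_isAdmissibleMerge_left huv hu (by
      by_contra h
      push Not at h
      exact hx (rank_eq_zero_iff.2 h))
    obtain ⟨y, rfl⟩ := hmem q hq
    exact ⟨y, (hcov y x hqx).lt, hqx.rank_eq⟩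
  · have htop : Admissible u v (⊤ : Setoid (Fin (n + 1))) :=
      ⟨fun _ _ _ _ _ _ _ _ _ => trivial, fun _ _ _ _ _ => trivial,
        fun h => h.ne_zero (h.min.eq (isBlockMin_zero _) trivial), fun _ => trivial⟩
    obtain ⟨e, -, hen, had, -⟩ := exists_path_from huv hu _ ⟨⊤, htop.noncrossing⟩ htop
      (Nat.add_sub_of_le (rank_le _))
    obtain ⟨x, hx⟩ := hmem (e n) (had n (rank_le _))
    exact ⟨x, hx ▸ hen⟩
  · obtain ⟨ι, c, lo, inj, rng, full, edge⟩ := hasSymmetricPaths_admissible huv hu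
    refine ⟨ι, fun x => c x.1, lo, ?_, ?_, ?_, ?_⟩
    · exact fun x _ y _ h1 h2 => Subtype.ext (inj _ (hadm x) _ (hadm y) h1 h2)
    · exact fun x _ => rng _ (hadm x)
    · intro x _ t h1 h2
      obtain ⟨q, hq, h3, h4⟩ := full _ (hadm x) t h1 h2
      obtain ⟨y, rfl⟩ := hmem q hq
      exact ⟨y, trivial, h3, h4⟩
    · exact fun x _ y _ h1 h2 => hcov x y (edge _ (hadm x) _ (hadm y) h1 h2)
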